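/- Let $\mu_\sigma,\mu_\varepsilon$ be non-zero finite positive Borel measures on $\mathbb R$ concentrated on $[0,1]$ such that * (T) $\mu_\varepsilon(\alpha)\times\mu_\sigma(\beta)-\mu_\sigma(\alpha)\times\mu_\varepsilon(\beta)$ is a non-negative measure on $\Delta=\{(\alpha,\beta)\in[0,1]^2:\alpha>\beta\}$; * the model is properly fractional: $(\operatorname{supp}\mu_\sigma\cup\operatorname{supp}\mu_\varepsilon)\cap(0,1)\neq\emptyset$; * $\mu_\sigma$ is not a constant multiple of $\mu_\varepsilon$. For $\operatorname{Re}s>0$ put $\Phi_\sigma(s)=\int s^\alpha\,d\mu_\sigma(\alpha)$, $\Phi_\varepsilon(s)=\int s^\alpha\,d\mu_\varepsilon(\alpha)$ and $\Psi(s)=\sqrt{\Phi_\sigma(s)/\Phi_\varepsilon(s)}$ (principal branches). Let $S$ be the distribution on $\mathbb R^2$ whose Laplace transform in $t$ is $\tilde S(x,s)=\frac{\Psi(s)}{2s}e^{-|x|s\Psi(s)}$, that is, for any $a>0$ and any test function $\varphi$, $$\langle S,\varphi\rangle=\int_{\mathbb R}\int_{\mathbb R}\tilde S(x,a+iy)\,\frac1{2\pi}\int_{\mathbb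 R}\varphi(x,t)e^{(a+iy)t}\,dt\,dy\,dx,$$ and let $K=\partial_tS$ in the sense of distributions. Then the half-line $\{0\}\times[0,\infty)$ is a set of discontinuity for $\partial_xK$. Precisely: 1. There is an open set $\Omega\supseteq\{0\}\times(0,\infty)$ on which $K$ is a continuous function that is $C^1$ on $\Omega\setminus\{x=0\}$, and for every $t>0$ the pointwise derivative $\partial_xK$ has (finite) limits at $(0,t)$ from $\{x>0\}$ and from $\{x<0\}$, and these two limits are different. 2. For every $t\ge0$ there is no open neighbourhood $U$ of $(0,t)$ on which the distribution $\partial_xK$ is given by a locally integrable function that is continuous at $(0,t)$. 3. For every $t\ge0$, $K$ is not a $C^1$ function on any open neighbourhood of $(0,t)$. -/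

import Mathlib

open MeasureTheory Set Filter Topology
open scoped NNReal ContDiff

namespace FractionalWave

/-- The triangle `{(α, β) ∈ [0,1]² : β < α}`. -/
def triangle : Set (ℝ × ℝ) :=
  {p | p.1 ∈ Icc (0 : ℝ) 1 ∧ p.2 ∈ Icc (0 : ℝ) 1 ∧ p.2 < p.1}

/-- The thermodynamical restriction: `με(α) × μσ(β) - μσ(α) × με(β)` is a non-negative measure
on the triangle. -/
def ThermoRestriction (μσ με : Measure ℝ) : Prop :=
  ∀ A : Set (ℝ × ℝ), MeasurableSet A → A ⊆ triangle → (μσ.prod με) A ≤ (με.prod μσ) A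

/-- The support of one of the two measures meets the open interval `(0,1)`. -/
def IsProperFractional (μσ με : Measure ℝ) : Prop :=
  ((μσ.support ∪ με.support) ∩ Ioo (0 : ℝ) 1).Nonempty

/-- `Φ(s) = ∫ s^α dμ(α)` (principal branch). -/
noncomputable def Phi (μ : Measure ℝ) (s : ℂ) : ℂ :=
  ∫ α : ℝ, s ^ (α : ℂ) ∂μ

/-- `Ψ(s) = √(Φσ(s) / Φε(s))` (principal branch); it is only used for `Re s > 0`. -/
noncomputable def Psi (μσ με : Measure ℝ) (s : ℂ) : ℂ :=
  (Phi μσ s / Phi με s) ^ (1 / 2 : ℂ)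

/-- The Laplace transform with respect to time of the fundamental solution,
`Ψ(s) / (2 s) · exp (-|x| s Ψ(s))`. -/
noncomputable def STilde (μσ με : Measure ℝ) (x : ℝ) (s : ℂ) : ℂ :=
  Psi μσ με s / (2 * s) * Complex.exp (-((|x| : ℝ) : ℂ) * s * Psi μσ με s)

/-- The inverse Laplace transform with respect to `t`, in the sense of distributions, of a family
`F x s` defined for `Re s > 0`: as a functional on test functions `φ(x, t)` it is
`∫∫ F x (a + i y) · (1 / 2π) ∫ φ(x, t) exp ((a + i y) t) dt dy dx`,
that is, `exp (a t)` times the inverse Fourier transform of `y ↦ F x (a + i y)`,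
where `a > 0` is the abscissa of the line of integration. -/
noncomputable def invLaplace (F : ℝ → ℂ → ℂ) (a : ℝ) (φ : ℝ × ℝ → ℂ) : ℂ :=
  ∫ x : ℝ, ∫ y : ℝ, F x ((a : ℂ) + (y : ℂ) * Complex.I) *
    ((1 / (2 * (Real.pi : ℂ))) *
      ∫ t : ℝ, φ (x, t) * Complex.exp (((a : ℂ) + (y : ℂ) * Complex.I) * (t : ℂ)))

/-- The partial derivative with respect to `x` of a function of `(x, t)`. -/
noncomputable def partialX (f : ℝ × ℝ → ℂ) (p : ℝ × ℝ) : ℂ := fderiv ℝ f p (1, 0)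

/-- The partial derivative with respect to `t` of a function of `(x, t)`. -/
noncomputable def partialT (f : ℝ × ℝ → ℂ) (p : ℝ × ℝ) : ℂ := fderiv ℝ f p (0, 1)

/-- The distributional derivative `∂T/∂x`. -/
noncomputable def distPartialX (T : (ℝ × ℝ → ℂ) → ℂ) (φ : ℝ × ℝ → ℂ) : ℂ := -T (partialX φ)

/-- The distributional derivative `∂T/∂t`. -/
noncomputable def distPartialT (T : (ℝ × ℝ → ℂ) → ℂ) (φ : ℝ × ℝ → ℂ) : ℂ := -T (partialT φ)

/-- The distribution `T` coincides on the open set `U` with the locally integrable function `g`. -/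
def RepresentedOn (T : (ℝ × ℝ → ℂ) → ℂ) (U : Set (ℝ × ℝ)) (g : ℝ × ℝ → ℂ) : Prop :=
  LocallyIntegrableOn g U ∧
    ∀ φ : ℝ × ℝ → ℂ, ContDiff ℝ ∞ φ → HasCompactSupport φ → tsupport φ ⊆ U →
      T φ = ∫ p : ℝ × ℝ, g p * φ p

/-- The fundamental solution `S`, a distribution on `ℝ²`. -/
noncomputable def S (μσ με : Measure ℝ) (a : ℝ) : (ℝ × ℝ → ℂ) → ℂ :=
  invLaplace (STilde μσ με) a

/-- `K = ∂S/∂t`, a distribution on `ℝ²`. -/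
noncomputable def K (μσ με : Measure ℝ) (a : ℝ) : (ℝ × ℝ → ℂ) → ℂ :=
  distPartialT (S μσ με a)

end FractionalWave

/-!
`S`, and with it `K = ∂S/∂t`, is given by an inverse Laplace integral over the line `Re s = a`;
that of `K` is `½ Ψ(s) e^{-|x| s Ψ(s)}`. All the powers `s ^ α`, `α ∈ [0, 1]`, lie in the sector
spanned by `1` and `s`, so that `Φσ` and `Φε` have no zeros off the negative half-line and `Ψ` is
holomorphic there. The restriction (T) says that integrals of antisymmetric kernels which are
non-negative on the triangle, taken against `μσ × με`, are non-positive
(`integral_antisymm_nonpos`). This is used three times: `Φσ / Φε` is non-increasing on the positive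
half-line, which bounds `Ψ` at infinity (`exists_norm_Psi_le`); `Im Ψ²` and `Im s` have opposite
signs, which bounds `Re (s Ψ(s))` below by `|Ψ(s)| min (Re s, 0)` (`min_le_re_mul_Psi`); and
`Im (Φσ / Φε) < 0` on the upper side of the cut, the inequality being strict because the model is
properly fractional and `μσ` is not a multiple of `με` (`phiRatio_im_neg`).

By the first two facts the vertical line can be turned into the two rays from `a` in the directions
`e^{± 2πi/3}`, as long as `(x, t)` stays in a cone `c |x| < t` (`integral_STilde`). On the rays
`e^{st}` decays exponentially and beats `e^{-ξ s Ψ}` for `ξ` of either sign. Hence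
`K(x, t) = G(|x|, t)` in the cone (`representedOn_K`) for a function `G` which is continuously
differentiable across `ξ = 0` (`waveProfile_regular`), and the one-sided limits of `∂K/∂x` at
`(0, t)` are `± ∂G/∂ξ(0, t)`, where `∂G/∂ξ(0, t)` is the inverse Laplace transform of
`-½ s Ψ(s)² = -½ s Φσ(s) / Φε(s)`. For this last function the rays can be folded onto the two sides
of the cut, and the jump becomes
`-(1/π) ∫ ρ e^{-ρ t} Im (Φσ / Φε)(-ρ + i0) dρ` over `ρ > 0`
(`bromwich_jumpKernel`). By the third fact it is positive, and it does not increase with `t`. So the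
jump stays away from zero near every `t ≥ 0`, including `t = 0`, and `∂K/∂x` cannot be
continuous there (`not_continuousAt_distPartialX_K`).
-/

namespace FractionalWave
open ProbabilityTheory

/-! ### Antisymmetric kernels and the thermodynamical restriction -/

lemma measurableSet_triangle : MeasurableSet triangle := by
  unfold triangle
  refine (measurableSet_Icc.preimage measurable_fst).inter
    ((measurableSet_Icc.preimage measurable_snd).inter ?_)
  exact measurableSet_lt measurable_snd measurable_fst

lemma ThermoRestriction.restrict_le {μσ με : Measure ℝ} (hT : ThermoRestriction μσ με) :
    (μσ.prod με).restrict triangle ≤ (με.prod μσ).restrict triangle := by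
  refine Measure.le_iff.2 fun A hA => ?_
  rw [Measure.restrict_apply hA, Measure.restrict_apply hA]
  exact hT _ (hA.inter measurableSet_triangle) inter_subset_right

lemma ae_prod_mem_Icc {μ ν : Measure ℝ} [IsFiniteMeasure μ] [IsFiniteMeasure ν]
    (hμ : μ (Icc (0 : ℝ) 1)ᶜ = 0) (hν : ν (Icc (0 : ℝ) 1)ᶜ = 0) :
    ∀ᵐ p ∂(μ.prod ν), p.1 ∈ Icc (0 : ℝ) 1 ∧ p.2 ∈ Icc (0 : ℝ) 1 := by
  have h1 : ∀ᵐ x ∂μ, x ∈ Icc (0 : ℝ) 1 := hμ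
  have h2 : ∀ᵐ x ∂ν, x ∈ Icc (0 : ℝ) 1 := hν
  filter_upwards [Measure.quasiMeasurePreserving_fst.ae h1,
    Measure.quasiMeasurePreserving_snd.ae h2] with p hp1 hp2 using ⟨hp1, hp2⟩

section Antisymmetric
variable {μσ με : Measure ℝ} [IsFiniteMeasure μσ] [IsFiniteMeasure με]

/-- Only the triangle contributes to the integral of an antisymmetric kernel. -/
lemma integral_antisymm (hσ : μσ (Icc (0 : ℝ) 1)ᶜ = 0) (hε : με (Icc (0 : ℝ) 1)ᶜ = 0)
    {w : ℝ × ℝ → ℝ} (hw : Integrable w (μσ.prod με)) (hw' : Integrable w (με.prod μσ))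
    (hanti : ∀ p, w p.swap = - w p) :
    ∫ p, w p ∂(μσ.prod με) =
      ∫ p in triangle, w p ∂(μσ.prod με) - ∫ p in triangle, w p ∂(με.prod μσ) := by
  rw [← integral_indicator measurableSet_triangle, ← integral_indicator measurableSet_triangle,
    ← integral_prod_swap (μ := με) (ν := μσ), ← integral_sub]
  · refine integral_congr_ae ?_
    filter_upwards [ae_prod_mem_Icc hσ hε] with p ⟨h1, h2⟩
    rcases lt_trichotomy p.1 p.2 with h | h | h
    · have ha : p ∉ triangle := fun hp => absurd hp.2.2 (not_lt.2 h.le)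
      have hb : p.swap ∈ triangle := ⟨h2, h1, h⟩
      simp [indicator_of_notMem ha, indicator_of_mem hb, hanti]
    · have ha : p ∉ triangle := fun hp => absurd hp.2.2 (not_lt.2 h.le)
      have hb : p.swap ∉ triangle := fun hp => absurd hp.2.2 (not_lt.2 h.ge)
      have h0 : w p = - w p := by
        conv_lhs => rw [← Prod.swap_swap p, hanti]
        congr 2
        exact Prod.ext h.symm h
      simp only [indicator_of_notMem ha, indicator_of_notMem hb]
      linarith
    · have ha : p ∈ triangle := ⟨h1, h2, h⟩
      have hb : p.swap ∉ triangle := fun hp => absurd hp.2.2 (not_lt.2 h.le)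
      simp [indicator_of_notMem hb, indicator_of_mem ha]
  · exact hw.indicator measurableSet_triangle
  · exact (hw'.indicator measurableSet_triangle).swap

lemma integral_antisymm_nonpos (hσ : μσ (Icc (0 : ℝ) 1)ᶜ = 0) (hε : με (Icc (0 : ℝ) 1)ᶜ = 0)
    (hT : ThermoRestriction μσ με)
    {w : ℝ × ℝ → ℝ} (hw : Integrable w (μσ.prod με)) (hw' : Integrable w (με.prod μσ))
    (hanti : ∀ p, w p.swap = - w p) (hpos : ∀ p ∈ triangle, 0 ≤ w p) :
    ∫ p, w p ∂(μσ.prod με) ≤ 0 := by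
  rw [integral_antisymm hσ hε hw hw' hanti, sub_nonpos]
  exact integral_mono_measure hT.restrict_le
    (ae_restrict_of_forall_mem measurableSet_triangle hpos) hw'.integrableOn

/-- If the integral of an antisymmetric kernel which is positive on the triangle, except possibly
at its vertex `(1, 0)`, vanishes, then the two product measures agree on the triangle without
this vertex. -/
lemma prod_eq_of_integral_antisymm_eq_zero
    (hσ : μσ (Icc (0 : ℝ) 1)ᶜ = 0) (hε : με (Icc (0 : ℝ) 1)ᶜ = 0)
    (hT : ThermoRestriction μσ με)
    {w : ℝ × ℝ → ℝ} (hw : Integrable w (μσ.prod με)) (hw' : Integrable w (με.prod μσ))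
    (hanti : ∀ p, w p.swap = - w p) (hnonneg : ∀ p ∈ triangle, 0 ≤ w p)
    (hpos : ∀ p ∈ triangle, p ≠ (1, 0) → 0 < w p)
    (h0 : ∫ p, w p ∂(μσ.prod με) = 0)
    {A : Set (ℝ × ℝ)} (hA : MeasurableSet A) (hAt : A ⊆ triangle) (hA1 : ((1 : ℝ), (0 : ℝ)) ∉ A) :
    (μσ.prod με) A = (με.prod μσ) A := by
  set P := (μσ.prod με).restrict triangle with hP
  set Q := (με.prod μσ).restrict triangle with hQ
  have hle : P ≤ Q := hT.restrict_le
  set ν := Q - P with hν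
  have hadd : ν + P = Q := Measure.sub_add_cancel_of_le hle
  have hwP : Integrable w P := hw.integrableOn
  have hwQ : Integrable w Q := hw'.integrableOn
  have hwν : Integrable w ν := hwQ.mono_measure Measure.sub_le
  have hint : ∫ p, w p ∂ν = 0 := by
    have := integral_antisymm hσ hε hw hw' hanti
    rw [h0, ← hP, ← hQ, ← hadd, integral_add_measure hwν hwP] at this
    linarith
  have hνt : ∀ᵐ p ∂ν, p ∈ triangle :=
    (Measure.absolutelyContinuous_of_le (Measure.sub_le : ν ≤ Q)).ae_le
      (ae_restrict_mem measurableSet_triangle)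
  have hz := (integral_eq_zero_iff_of_nonneg_ae
    (hνt.mono fun p hp => hnonneg p hp) hwν).1 hint
  have hνA : ν A = 0 := by
    refine measure_mono_null (t := {p | ¬ w p = 0}) (fun p hp => ?_) hz
    exact (hpos p (hAt hp) (fun h => hA1 (h ▸ hp))).ne'
  have h1 : P A = (μσ.prod με) A := by
    rw [hP, Measure.restrict_apply hA, inter_eq_left.2 hAt]
  have h2 : Q A = (με.prod μσ) A := by
    rw [hQ, Measure.restrict_apply hA, inter_eq_left.2 hAt]
  rw [← h1, ← h2, ← hadd, Measure.add_apply, hνA, zero_add]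

/-- For a properly fractional model with `μσ` not a multiple of `με`, the two product measures
differ on the triangle without its vertex `(1, 0)`. -/
lemma not_prod_eq_on_triangle
    (hσ : μσ (Icc (0 : ℝ) 1)ᶜ = 0) (hε : με (Icc (0 : ℝ) 1)ᶜ = 0) (hε_ne : με ≠ 0)
    (hproper : IsProperFractional μσ με) (hprop : ¬ ∃ c : ℝ≥0, μσ = c • με)
    (h : ∀ A : Set (ℝ × ℝ), MeasurableSet A → A ⊆ triangle → ((1 : ℝ), (0 : ℝ)) ∉ A →
      (μσ.prod με) A = (με.prod μσ) A) : False := by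
  -- the swap exchanges the two products, so they agree off the triangle as well
  have hswap : ∀ A : Set (ℝ × ℝ), MeasurableSet A →
      (με.prod μσ) (Prod.swap ⁻¹' A) = (μσ.prod με) A := fun A hA => by
    rw [← Measure.prod_swap (μ := με) (ν := μσ), Measure.map_apply measurable_swap hA]
  have hswap' : ∀ A : Set (ℝ × ℝ), MeasurableSet A →
      (μσ.prod με) (Prod.swap ⁻¹' A) = (με.prod μσ) A := fun A hA => by
    rw [← Measure.prod_swap (μ := μσ) (ν := με), Measure.map_apply measurable_swap hA]
  have key : ∀ B : Set ℝ, MeasurableSet B →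
      (μσ.prod με) (Ioo (0 : ℝ) 1 ×ˢ B) = (με.prod μσ) (Ioo (0 : ℝ) 1 ×ˢ B) := by
    intro B hB
    set X : Set (ℝ × ℝ) := Ioo (0 : ℝ) 1 ×ˢ B with hX
    have hXm : MeasurableSet X := measurableSet_Ioo.prod hB
    have hTm : MeasurableSet triangle := measurableSet_triangle
    have hTm' : MeasurableSet (Prod.swap ⁻¹' triangle : Set (ℝ × ℝ)) :=
      measurable_swap hTm
    have hDm : MeasurableSet {p : ℝ × ℝ | p.1 = p.2} :=
      measurableSet_eq_fun measurable_fst measurable_snd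
    -- the three parts of the strip: below, above and on the diagonal
    have e1 : (μσ.prod με) (X ∩ triangle) = (με.prod μσ) (X ∩ triangle) :=
      h _ (hXm.inter hTm) inter_subset_right fun hp => (lt_irrefl _ hp.1.1.2)
    have e2 : (μσ.prod με) (X ∩ Prod.swap ⁻¹' triangle) =
        (με.prod μσ) (X ∩ Prod.swap ⁻¹' triangle) := by
      rw [← hswap _ (hXm.inter hTm'), ← hswap' _ (hXm.inter hTm')]
      refine (h _ (measurable_swap (hXm.inter hTm')) ?_ ?_).symm
      · intro p hp
        simpa using hp.2
      · intro hp
        exact lt_irrefl _ hp.1.1.1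
    have e3 : (μσ.prod με) (X ∩ {p | p.1 = p.2}) = (με.prod μσ) (X ∩ {p | p.1 = p.2}) := by
      rw [← hswap _ (hXm.inter hDm)]
      congr 1
      ext p
      constructor
      · rintro ⟨⟨ha, hb⟩, hd⟩
        have hd' : p.1 = p.2 := hd.symm
        exact ⟨⟨hd' ▸ ha, hd' ▸ hb⟩, hd'⟩
      · rintro ⟨⟨ha, hb⟩, hd⟩
        have hd' : p.1 = p.2 := hd
        refine ⟨⟨?_, ?_⟩, hd'.symm⟩
        · change p.2 ∈ Ioo (0 : ℝ) 1
          exact hd' ▸ ha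
        · change p.1 ∈ B
          exact hd' ▸ hb
    have dec : ∀ ρ : Measure (ℝ × ℝ),
        (∀ᵐ p ∂ρ, p.1 ∈ Icc (0 : ℝ) 1 ∧ p.2 ∈ Icc (0 : ℝ) 1) →
        ρ X = ρ (X ∩ triangle) + ρ (X ∩ Prod.swap ⁻¹' triangle) + ρ (X ∩ {p | p.1 = p.2}) := by
      intro ρ hρ
      rw [← measure_union _ (hXm.inter hTm'), ← measure_union _ (hXm.inter hDm)]
      · refine measure_congr ?_
        filter_upwards [hρ] with p ⟨h1, h2⟩
        refine propext ⟨fun hp => ?_, fun hp => ?_⟩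
        · rcases lt_trichotomy p.1 p.2 with hl | hl | hl
          · exact Or.inl (Or.inr ⟨hp, h2, h1, hl⟩)
          · exact Or.inr ⟨hp, hl⟩
          · exact Or.inl (Or.inl ⟨hp, h1, h2, hl⟩)
        · rcases hp with (hp | hp) | hp <;> exact hp.1
      · rw [disjoint_left]
        rintro p (hp | hp) hq
        · exact hp.2.2.2.ne' hq.2
        · exact hp.2.2.2.ne hq.2
      · rw [disjoint_left]
        rintro p hp hq
        exact lt_asymm hp.2.2.2 hq.2.2.2
    rw [dec _ (ae_prod_mem_Icc hσ hε), dec _ (ae_prod_mem_Icc hε hσ), e1, e2, e3]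
  simp only [Measure.prod_prod] at key
  have hmeas : ∀ (μ : Measure ℝ), (μ.support ∩ Ioo (0 : ℝ) 1).Nonempty → μ (Ioo 0 1) ≠ 0 := by
    rintro μ ⟨x, hx, hx'⟩
    exact ((Measure.mem_support_iff_forall x).1 hx _ (isOpen_Ioo.mem_nhds hx')).ne'
  -- `key` says `μσ (0,1) • με = με (0,1) • μσ`
  by_cases hz : με (Ioo 0 1) = 0
  · have hσ0 : μσ (Ioo 0 1) ≠ 0 := by
      obtain ⟨x, hx | hx, hx'⟩ := hproper
      · exact hmeas _ ⟨x, hx, hx'⟩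
      · exact absurd hz (hmeas _ ⟨x, hx, hx'⟩)
    apply hε_ne
    have := key univ MeasurableSet.univ
    rw [hz, zero_mul, mul_eq_zero] at this
    exact Measure.measure_univ_eq_zero.1 (this.resolve_left hσ0)
  · apply hprop
    refine ⟨(μσ (Ioo 0 1) / με (Ioo 0 1)).toNNReal, ?_⟩
    ext B hB
    have hk := key B hB
    have hfin : μσ (Ioo 0 1) / με (Ioo 0 1) ≠ ⊤ :=
      ENNReal.div_ne_top (measure_ne_top _ _) hz
    rw [Measure.smul_apply, ENNReal.smul_def, ENNReal.coe_toNNReal hfin, smul_eq_mul,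
      ENNReal.mul_comm_div, ← mul_div_assoc, hk, mul_comm,
      ENNReal.mul_div_cancel_right hz (measure_ne_top _ _)]

end Antisymmetric

/-! ### The functions Φ and Ψ on the slit plane -/

section Phi
variable {μ : Measure ℝ} [IsFiniteMeasure μ]

lemma integrable_exp_mul_of_Icc (hμ : μ (Icc (0 : ℝ) 1)ᶜ = 0) (ρ : ℝ) :
    Integrable (fun α : ℝ => Real.exp (ρ * α)) μ :=
  integrable_exp_mul_of_mem_Icc (X := id) (a := 0) (b := 1) aemeasurable_id hμ

lemma integrable_cexp_mul_of_Icc (hμ : μ (Icc (0 : ℝ) 1)ᶜ = 0) (z : ℂ) :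
    Integrable (fun α : ℝ => Complex.exp (z * α)) μ := by
  refine (integrable_exp_mul_of_Icc hμ z.re).mono' (by fun_prop) (ae_of_all _ fun α => ?_)
  simp [Complex.norm_exp]

lemma Phi_eq_complexMGF (μ : Measure ℝ) {s : ℂ} (hs : s ≠ 0) :
    Phi μ s = complexMGF id μ (Complex.log s) := by
  simp [Phi, complexMGF, Complex.cpow_def_of_ne_zero hs]

lemma differentiable_complexMGF_of_Icc (hμ : μ (Icc (0 : ℝ) 1)ᶜ = 0) :
    Differentiable ℂ (complexMGF id μ) := fun z => by
  refine (hasDerivAt_complexMGF (X := id) (μ := μ) ?_).differentiableAt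
  have : integrableExpSet id μ = univ :=
    eq_univ_of_forall fun ρ => integrable_exp_mul_of_Icc hμ ρ
  simp [this]

lemma differentiableAt_Phi (hμ : μ (Icc (0 : ℝ) 1)ᶜ = 0) {s : ℂ} (hs : s ∈ Complex.slitPlane) :
    DifferentiableAt ℂ (Phi μ) s := by
  have h1 : DifferentiableAt ℂ (fun s => complexMGF id μ (Complex.log s)) s :=
    ((differentiable_complexMGF_of_Icc hμ) _).comp s (Complex.differentiableAt_log hs)
  refine h1.congr_of_eventuallyEq ?_
  filter_upwards [Complex.isOpen_slitPlane.mem_nhds hs] with w hw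
  exact Phi_eq_complexMGF μ (Complex.slitPlane_ne_zero hw)

lemma mgf_pos_of_Icc (hμ : μ (Icc (0 : ℝ) 1)ᶜ = 0) (h0 : μ ≠ 0) (ρ : ℝ) : 0 < mgf id μ ρ :=
  mgf_pos' h0 (integrable_exp_mul_of_Icc hμ ρ)

lemma norm_Phi_le (μ : Measure ℝ) {s : ℂ} (hs : s ≠ 0) : ‖Phi μ s‖ ≤ mgf id μ (Real.log ‖s‖) := by
  rw [Phi_eq_complexMGF μ hs, ← Complex.log_re]
  exact norm_complexMGF_le_mgf

/-- All the values `s ^ α` with `α ∈ [0, 1]` lie in the sector spanned by `1` and `s`, whose axis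
has direction `arg s / 2`. -/
lemma cos_mul_mgf_le_re (hμ : μ (Icc (0 : ℝ) 1)ᶜ = 0) {s : ℂ} (hs : s ≠ 0) :
    Real.cos (s.arg / 2) * mgf id μ (Real.log ‖s‖) ≤
      (Complex.exp (-(s.arg / 2 : ℝ) * Complex.I) * Phi μ s).re := by
  rw [Phi_eq_complexMGF μ hs, complexMGF, mgf, ← integral_const_mul, ← integral_const_mul]
  have hint := (integrable_cexp_mul_of_Icc hμ (Complex.log s)).const_mul
    (Complex.exp (-(s.arg / 2 : ℝ) * Complex.I))
  have hre := Complex.reCLM.integral_comp_comm hint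
  simp only [Complex.reCLM_apply] at hre
  simp only [id]
  rw [← hre]
  refine integral_mono_ae ((integrable_exp_mul_of_Icc hμ _).const_mul _) hint.re ?_
  have hμ' : ∀ᵐ x ∂μ, x ∈ Icc (0 : ℝ) 1 := hμ
  filter_upwards [hμ'] with α hα
  have e : Complex.exp (-(s.arg / 2 : ℝ) * Complex.I) * Complex.exp (Complex.log s * α) =
      Complex.exp ((Real.log ‖s‖ * α : ℝ) + (s.arg * α - s.arg / 2 : ℝ) * Complex.I) := by
    rw [← Complex.exp_add, Complex.log]
    congr 1
    push_cast
    ring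
  have e2 : (Complex.exp (-(s.arg / 2 : ℝ) * Complex.I) * Complex.exp (Complex.log s * α)).re =
      Real.exp (Real.log ‖s‖ * α) * Real.cos (s.arg * α - s.arg / 2) := by
    rw [e, Complex.exp_re]
    simp
  change _ ≤ (Complex.exp (-(s.arg / 2 : ℝ) * Complex.I) * Complex.exp (Complex.log s * α)).re
  rw [e2, mul_comm]
  refine mul_le_mul_of_nonneg_left ?_ (Real.exp_pos _).le
  rw [← Real.cos_abs (s.arg / 2), ← Real.cos_abs (s.arg * α - s.arg / 2)]
  refine Real.cos_le_cos_of_nonneg_of_le_pi (abs_nonneg _) ?_ ?_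
  · rw [abs_div, abs_two]
    linarith [Complex.abs_arg_le_pi s, abs_nonneg s.arg]
  · have : s.arg * α - s.arg / 2 = s.arg * (α - 1 / 2) := by ring
    rw [this, abs_mul, abs_div, abs_two, div_eq_mul_one_div]
    refine mul_le_mul_of_nonneg_left ?_ (abs_nonneg _)
    rw [abs_le]
    constructor <;> linarith [hα.1, hα.2]

lemma cos_mul_mgf_le_norm_Phi (hμ : μ (Icc (0 : ℝ) 1)ᶜ = 0) {s : ℂ} (hs : s ≠ 0) :
    Real.cos (s.arg / 2) * mgf id μ (Real.log ‖s‖) ≤ ‖Phi μ s‖ := by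
  refine (cos_mul_mgf_le_re hμ hs).trans ((Complex.re_le_norm _).trans ?_)
  rw [norm_mul, ← Complex.ofReal_neg, Complex.norm_exp_ofReal_mul_I, one_mul]

lemma cos_arg_half_pos {s : ℂ} (hs : s ∈ Complex.slitPlane) : 0 < Real.cos (s.arg / 2) := by
  have h1 := Complex.neg_pi_lt_arg s
  have h2 := lt_of_le_of_ne (Complex.arg_le_pi s) (Complex.slitPlane_arg_ne_pi hs)
  exact Real.cos_pos_of_mem_Ioo ⟨by linarith, by linarith⟩

lemma Phi_ne_zero (hμ : μ (Icc (0 : ℝ) 1)ᶜ = 0) (h0 : μ ≠ 0) {s : ℂ}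
    (hs : s ∈ Complex.slitPlane) : Phi μ s ≠ 0 := by
  have := cos_mul_mgf_le_norm_Phi hμ (Complex.slitPlane_ne_zero hs)
  have h2 := mul_pos (cos_arg_half_pos hs) (mgf_pos_of_Icc hμ h0 (Real.log ‖s‖))
  exact norm_pos_iff.1 (h2.trans_le this)

lemma Phi_conj (μ : Measure ℝ) {s : ℂ} (hs : s ∈ Complex.slitPlane) :
    Phi μ ((starRingEnd ℂ) s) = (starRingEnd ℂ) (Phi μ s) := by
  rw [Phi, Phi, ← integral_conj]
  congr 1
  ext α
  rw [Complex.conj_cpow _ _ (Complex.slitPlane_arg_ne_pi hs), Complex.conj_ofReal]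

end Phi

/-- Rotating `Φσ(s)` and `Φε(s)` by `e^{-i arg s / 2}` brings both into the right half-plane, so this
keeps their quotient off the branch cut of the square root. -/
lemma div_mem_slitPlane_of_re_pos {A B : ℂ} (hA : 0 < A.re) (hB : 0 < B.re) :
    A / B ∈ Complex.slitPlane := by
  have hB0 : B ≠ 0 := fun h => by simp [h] at hB
  rw [Complex.mem_slitPlane_iff_not_le_zero]
  intro h
  obtain ⟨h1, h2⟩ := Complex.le_def.1 h
  have hr : A / B = ((A / B).re : ℂ) := Complex.ext rfl (by simpa using h2)
  have hAB : A = ((A / B).re : ℂ) * B := by rw [← hr]; field_simp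
  have := congrArg Complex.re hAB
  rw [Complex.re_ofReal_mul] at this
  simp only [Complex.zero_re] at h1
  nlinarith [mul_nonneg (neg_nonneg.2 h1) hB.le]

/-- The standing assumptions on the two constitutive measures. -/
structure Admissible (μσ με : Measure ℝ) : Prop where
  σ_supp : μσ (Icc (0 : ℝ) 1)ᶜ = 0
  ε_supp : με (Icc (0 : ℝ) 1)ᶜ = 0
  σ_ne : μσ ≠ 0
  ε_ne : με ≠ 0
  thermo : ThermoRestriction μσ με
  proper : IsProperFractional μσ με
  not_multiple : ¬ ∃ c : ℝ≥0, μσ = c • με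

/-- The quotient `Φσ / Φε = Ψ²`. On the negative half-line the principal powers make it the
boundary value from the upper half-plane. -/
noncomputable def phiRatio (μσ με : Measure ℝ) (s : ℂ) : ℂ := Phi μσ s / Phi με s

lemma phiRatio_conj (μσ με : Measure ℝ) {s : ℂ} (hs : s ∈ Complex.slitPlane) :
    phiRatio μσ με ((starRingEnd ℂ) s) = (starRingEnd ℂ) (phiRatio μσ με s) := by
  rw [phiRatio, phiRatio, Phi_conj _ hs, Phi_conj _ hs, map_div₀]

lemma phiRatio_im (μσ με : Measure ℝ) (s : ℂ) : (phiRatio μσ με s).im =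
    (Phi μσ s * (starRingEnd ℂ) (Phi με s)).im / Complex.normSq (Phi με s) := by
  rw [phiRatio, Complex.div_im, Complex.mul_im, Complex.conj_re, Complex.conj_im]
  ring

section Ratio
variable {μσ με : Measure ℝ} [IsFiniteMeasure μσ] [IsFiniteMeasure με]

lemma phiRatio_mem_slitPlane (h : Admissible μσ με) {s : ℂ} (hs : s ∈ Complex.slitPlane) :
    phiRatio μσ με s ∈ Complex.slitPlane := by
  have hs0 := Complex.slitPlane_ne_zero hs
  have e : phiRatio μσ με s = (Complex.exp (-(s.arg / 2 : ℝ) * Complex.I) * Phi μσ s) /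
      (Complex.exp (-(s.arg / 2 : ℝ) * Complex.I) * Phi με s) := by
    rw [mul_div_mul_left _ _ (Complex.exp_ne_zero _), phiRatio]
  rw [e]
  exact div_mem_slitPlane_of_re_pos
    ((mul_pos (cos_arg_half_pos hs) (mgf_pos_of_Icc h.σ_supp h.σ_ne _)).trans_le
      (cos_mul_mgf_le_re h.σ_supp hs0))
    ((mul_pos (cos_arg_half_pos hs) (mgf_pos_of_Icc h.ε_supp h.ε_ne _)).trans_le
      (cos_mul_mgf_le_re h.ε_supp hs0))

lemma differentiableAt_phiRatio (h : Admissible μσ με) {s : ℂ} (hs : s ∈ Complex.slitPlane) :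
    DifferentiableAt ℂ (phiRatio μσ με) s :=
  (differentiableAt_Phi h.σ_supp hs).div (differentiableAt_Phi h.ε_supp hs)
    (Phi_ne_zero h.ε_supp h.ε_ne hs)

lemma differentiableAt_Psi (h : Admissible μσ με) {s : ℂ} (hs : s ∈ Complex.slitPlane) :
    DifferentiableAt ℂ (Psi μσ με) s :=
  (differentiableAt_phiRatio h hs).cpow_const (phiRatio_mem_slitPlane h hs)

lemma Psi_sq (μσ με : Measure ℝ) (s : ℂ) : Psi μσ με s ^ 2 = phiRatio μσ με s := by
  rw [Psi, phiRatio, one_div]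
  exact Complex.cpow_ofNat_inv_pow _ 2

lemma Psi_re_pos (h : Admissible μσ με) {s : ℂ} (hs : s ∈ Complex.slitPlane) :
    0 < (Psi μσ με s).re := by
  have hR := phiRatio_mem_slitPlane h hs
  have h0 : phiRatio μσ με s ≠ 0 := Complex.slitPlane_ne_zero hR
  change 0 < (phiRatio μσ με s ^ (1 / 2 : ℂ)).re
  rw [Complex.cpow_def_of_ne_zero h0, Complex.exp_re]
  refine mul_pos (Real.exp_pos _) ?_
  have : (Complex.log (phiRatio μσ με s) * (1 / 2 : ℂ)).im = (phiRatio μσ με s).arg / 2 := by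
    rw [show (1 / 2 : ℂ) = ((1 / 2 : ℝ) : ℂ) by push_cast; rfl, Complex.im_mul_ofReal,
      Complex.log_im]
    ring
  rw [this]
  exact cos_arg_half_pos hR

/-- The kernel of `Im (Φσ(s) conj Φε(s))` as an integral against `μσ × με`. -/
noncomputable def imKernel (s : ℂ) (p : ℝ × ℝ) : ℝ :=
  Real.exp (Real.log ‖s‖ * (p.1 + p.2)) * Real.sin (s.arg * (p.1 - p.2))

lemma integrable_imKernel {μ ν : Measure ℝ} [IsFiniteMeasure μ] [IsFiniteMeasure ν]
    (hμ : μ (Icc (0 : ℝ) 1)ᶜ = 0) (hν : ν (Icc (0 : ℝ) 1)ᶜ = 0) (s : ℂ) :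
    Integrable (imKernel s) (μ.prod ν) := by
  refine ((integrable_exp_mul_of_Icc hμ (Real.log ‖s‖)).mul_prod
    (integrable_exp_mul_of_Icc hν (Real.log ‖s‖))).mono' ?_ (ae_of_all _ fun p => ?_)
  · unfold imKernel
    fun_prop
  · rw [imKernel, norm_mul, Real.norm_eq_abs, Real.abs_exp, mul_add, Real.exp_add]
    exact mul_le_of_le_one_right (by positivity) (Real.abs_sin_le_one _)

lemma imKernel_swap (s : ℂ) (p : ℝ × ℝ) : imKernel s p.swap = - imKernel s p := by
  rw [imKernel, imKernel, ← mul_neg, ← Real.sin_neg, Prod.fst_swap, Prod.snd_swap, add_comm]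
  congr 2
  ring

lemma imKernel_nonneg {s : ℂ} (hs : 0 ≤ s.arg) {p : ℝ × ℝ} (hp : p ∈ triangle) :
    0 ≤ imKernel s p := by
  refine mul_nonneg (Real.exp_pos _).le (Real.sin_nonneg_of_nonneg_of_le_pi ?_ ?_)
  · exact mul_nonneg hs (by linarith [hp.2.2])
  · have h1 := Complex.arg_le_pi s
    have h2 : p.1 - p.2 ≤ 1 := by linarith [hp.1.2, hp.2.1.1]
    nlinarith [hp.2.2]

lemma imKernel_pos {s : ℂ} (hs : 0 < s.arg) {p : ℝ × ℝ} (hp : p ∈ triangle) (hp1 : p ≠ (1, 0)) :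
    0 < imKernel s p := by
  refine mul_pos (Real.exp_pos _) (Real.sin_pos_of_pos_of_lt_pi ?_ ?_)
  · exact mul_pos hs (by linarith [hp.2.2])
  · have h1 := Complex.arg_le_pi s
    have h2 : p.1 - p.2 < 1 := by
      by_contra hc
      apply hp1
      have a1 := hp.1.2
      have a2 := hp.2.1.1
      exact Prod.ext (by simp only; linarith) (by simp only; linarith)
    nlinarith [hp.2.2]

lemma im_Phi_mul_conj (h : Admissible μσ με) {s : ℂ} (hs : s ≠ 0) :
    (Phi μσ s * (starRingEnd ℂ) (Phi με s)).im = ∫ p, imKernel s p ∂(μσ.prod με) := by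
  rw [Phi_eq_complexMGF _ hs, Phi_eq_complexMGF _ hs, complexMGF, complexMGF, ← integral_conj,
    ← integral_prod_mul]
  have hc : Integrable (fun α : ℝ => (starRingEnd ℂ) (Complex.exp (Complex.log s * α))) με :=
    (Complex.conjCLE.toContinuousLinearMap.integrable_comp
      (integrable_cexp_mul_of_Icc h.ε_supp (Complex.log s)))
  have hint := (integrable_cexp_mul_of_Icc h.σ_supp (Complex.log s)).mul_prod hc
  have him := Complex.imCLM.integral_comp_comm hint
  simp only [Complex.imCLM_apply] at him
  simp only [id]
  rw [← him]
  congr 1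
  ext p
  have e : Complex.exp (Complex.log s * p.1) *
      (starRingEnd ℂ) (Complex.exp (Complex.log s * p.2)) =
      Complex.exp ((Real.log ‖s‖ * (p.1 + p.2) : ℝ) + (s.arg * (p.1 - p.2) : ℝ) * Complex.I) := by
    rw [← Complex.exp_conj, ← Complex.exp_add, Complex.log]
    congr 1
    simp only [map_mul, map_add, Complex.conj_ofReal, Complex.conj_I]
    push_cast
    ring
  rw [e, Complex.exp_im, imKernel]
  simp

lemma phiRatio_im_nonpos (h : Admissible μσ με) {s : ℂ} (hs : s ≠ 0) (harg : 0 ≤ s.arg) :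
    (phiRatio μσ με s).im ≤ 0 := by
  rw [phiRatio_im, im_Phi_mul_conj h hs]
  exact div_nonpos_of_nonpos_of_nonneg (integral_antisymm_nonpos h.σ_supp h.ε_supp h.thermo
    (integrable_imKernel h.σ_supp h.ε_supp s) (integrable_imKernel h.ε_supp h.σ_supp s)
    (imKernel_swap s) (fun p hp => imKernel_nonneg harg hp)) (Complex.normSq_nonneg _)

lemma im_Phi_mul_conj_neg (h : Admissible μσ με) {s : ℂ} (hs : s ≠ 0) (harg : 0 < s.arg) :
    (Phi μσ s * (starRingEnd ℂ) (Phi με s)).im < 0 := by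
  rw [im_Phi_mul_conj h hs]
  have i1 := integrable_imKernel h.σ_supp h.ε_supp s
  have i2 := integrable_imKernel h.ε_supp h.σ_supp s
  refine lt_of_le_of_ne (integral_antisymm_nonpos h.σ_supp h.ε_supp h.thermo i1 i2
    (imKernel_swap s) (fun p hp => imKernel_nonneg harg.le hp)) fun h0 => ?_
  exact not_prod_eq_on_triangle h.σ_supp h.ε_supp h.ε_ne h.proper h.not_multiple
    fun A hA hAt hA1 => prod_eq_of_integral_antisymm_eq_zero h.σ_supp h.ε_supp h.thermo i1 i2
      (imKernel_swap s) (fun p hp => imKernel_nonneg harg.le hp)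
      (fun p hp hp1 => imKernel_pos harg hp hp1) h0 hA hAt hA1

lemma phiRatio_im_neg (h : Admissible μσ με) {s : ℂ} (hs : s ≠ 0) (harg : 0 < s.arg) :
    (phiRatio μσ με s).im < 0 := by
  have h1 := im_Phi_mul_conj_neg h hs harg
  rw [phiRatio_im]
  refine div_neg_of_neg_of_pos h1 (Complex.normSq_pos.2 fun h0 => ?_)
  simp [h0] at h1

/-- On the positive half-line `Φσ / Φε` is non-increasing. -/
lemma mgf_mul_mgf_le (h : Admissible μσ με) {ρ₁ ρ₂ : ℝ} (hρ : ρ₁ ≤ ρ₂) :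
    mgf id μσ ρ₂ * mgf id με ρ₁ ≤ mgf id μσ ρ₁ * mgf id με ρ₂ := by
  rw [mgf, mgf, mgf, mgf, ← integral_prod_mul, ← integral_prod_mul, ← sub_nonpos]
  have i1 : ∀ {μ ν : Measure ℝ} [IsFiniteMeasure μ] [IsFiniteMeasure ν],
      μ (Icc (0 : ℝ) 1)ᶜ = 0 → ν (Icc (0 : ℝ) 1)ᶜ = 0 → ∀ a b : ℝ,
      Integrable (fun p : ℝ × ℝ => Real.exp (a * id p.1) * Real.exp (b * id p.2)) (μ.prod ν) :=
    fun hμ hν a b => (integrable_exp_mul_of_Icc hμ a).mul_prod (integrable_exp_mul_of_Icc hν b)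
  rw [← integral_sub (i1 h.σ_supp h.ε_supp _ _) (i1 h.σ_supp h.ε_supp _ _)]
  refine integral_antisymm_nonpos h.σ_supp h.ε_supp h.thermo
    ((i1 h.σ_supp h.ε_supp _ _).sub (i1 h.σ_supp h.ε_supp _ _))
    ((i1 h.ε_supp h.σ_supp _ _).sub (i1 h.ε_supp h.σ_supp _ _)) (fun p => ?_) (fun p hp => ?_)
  · simp only [Prod.fst_swap, Prod.snd_swap]
    ring
  · simp only [id, ← Real.exp_add]
    rw [sub_nonneg, Real.exp_le_exp]
    nlinarith [hp.2.2]

/-- The region containing the contours `a + r e^{± iθ}`, `θ ≤ 2π/3`: there `|arg s| ≤ 2π/3`, and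
`s` stays away from the branch point. -/
def outerSector (a : ℝ) : Set ℂ := {s | a / 2 ≤ ‖s‖ ∧ -(‖s‖ / 2) ≤ s.re}

lemma outerSector_subset_slitPlane {a : ℝ} (ha : 0 < a) : outerSector a ⊆ Complex.slitPlane := by
  rintro s ⟨h1, h2⟩
  rw [Complex.mem_slitPlane_iff]
  by_contra! hc
  have : ‖s‖ = |s.re| := Complex.abs_re_eq_norm.2 hc.2 |>.symm
  rw [abs_of_nonpos hc.1] at this
  linarith

lemma half_le_cos_arg_half {s : ℂ} (hs : s ≠ 0) (h : -(‖s‖ / 2) ≤ s.re) :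
    1 / 2 ≤ Real.cos (s.arg / 2) := by
  have hpos : 0 < ‖s‖ := norm_pos_iff.2 hs
  have hc : -(1 / 2) ≤ Real.cos s.arg := by
    rw [Complex.cos_arg hs, le_div_iff₀ hpos]
    linarith
  have h2 : Real.cos s.arg = 2 * Real.cos (s.arg / 2) ^ 2 - 1 := by
    rw [← Real.cos_two_mul]
    congr 1
    ring
  have h0 : 0 ≤ Real.cos (s.arg / 2) :=
    Real.cos_nonneg_of_mem_Icc ⟨by linarith [Complex.neg_pi_lt_arg s],
      by linarith [Complex.arg_le_pi s]⟩
  nlinarith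

lemma exists_norm_Psi_le (h : Admissible μσ με) {a : ℝ} (ha : 0 < a) :
    ∃ C : ℝ, 0 < C ∧ ∀ s ∈ outerSector a, ‖Psi μσ με s‖ ≤ C := by
  set Q : ℝ := mgf id μσ (Real.log (a / 2)) / mgf id με (Real.log (a / 2)) with hQ
  have hσp := mgf_pos_of_Icc h.σ_supp h.σ_ne
  have hεp := mgf_pos_of_Icc h.ε_supp h.ε_ne
  have hQ0 : 0 < Q := div_pos (hσp _) (hεp _)
  refine ⟨2 * Q + 1, by linarith, fun s hs => ?_⟩
  have hs0 : s ≠ 0 := Complex.slitPlane_ne_zero (outerSector_subset_slitPlane ha hs)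
  have hcos := half_le_cos_arg_half hs0 hs.2
  have hlog : Real.log (a / 2) ≤ Real.log ‖s‖ := Real.log_le_log (by linarith) hs.1
  have h1 := norm_Phi_le μσ hs0
  have h2 := cos_mul_mgf_le_norm_Phi h.ε_supp hs0
  have h3 : 1 / 2 * mgf id με (Real.log ‖s‖) ≤ ‖Phi με s‖ :=
    (mul_le_mul_of_nonneg_right hcos (hεp _).le).trans h2
  have h4 : ‖phiRatio μσ με s‖ ≤ 2 * Q := by
    rw [phiRatio, norm_div, div_le_iff₀ (lt_of_lt_of_le (by linarith [hεp (Real.log ‖s‖)]) h3)]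
    have h5 : mgf id μσ (Real.log ‖s‖) ≤ Q * mgf id με (Real.log ‖s‖) := by
      rw [hQ, div_mul_eq_mul_div, le_div_iff₀ (hεp _)]
      exact mgf_mul_mgf_le h hlog
    nlinarith
  have h6 : ‖Psi μσ με s‖ ^ 2 ≤ 2 * Q := by rwa [← norm_pow, Psi_sq]
  nlinarith [sq_nonneg (‖Psi μσ με s‖ - 1), norm_nonneg (Psi μσ με s)]

/-- The damping estimate: `Re Ψ(s) > 0` and `Im Ψ(s)`, `Im s` have opposite signs, so only a
negative real part of `s` can make the real part of `s Ψ(s)` negative. -/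
lemma min_le_re_mul_Psi (h : Admissible μσ με) {s : ℂ} (hs : s ∈ Complex.slitPlane) :
    min 0 (‖Psi μσ με s‖ * s.re) ≤ (s * Psi μσ με s).re := by
  have hre := Psi_re_pos h hs
  have hle : (Psi μσ με s).re ≤ ‖Psi μσ με s‖ := Complex.re_le_norm _
  have him : s.im * (Psi μσ με s).im ≤ 0 := by
    have key : ∀ w ∈ Complex.slitPlane, 0 ≤ w.im → (Psi μσ με w).im ≤ 0 := by
      intro w hw hw0
      have h1 := phiRatio_im_nonpos h (Complex.slitPlane_ne_zero hw) (Complex.arg_nonneg_iff.2 hw0)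
      rw [← Psi_sq, pow_two, Complex.mul_im] at h1
      have h2 := Psi_re_pos h hw
      by_contra! hc
      nlinarith [mul_pos h2 hc]
    rcases le_total 0 s.im with h0 | h0
    · exact mul_nonpos_of_nonneg_of_nonpos h0 (key s hs h0)
    · refine mul_nonpos_of_nonpos_of_nonneg h0 ?_
      have hs' : (starRingEnd ℂ) s ∈ Complex.slitPlane := by
        rw [Complex.mem_slitPlane_iff] at hs ⊢
        simpa using hs
      have hconj : Psi μσ με ((starRingEnd ℂ) s) = (starRingEnd ℂ) (Psi μσ με s) := by
        change phiRatio μσ με _ ^ (1 / 2 : ℂ) = (starRingEnd ℂ) (phiRatio μσ με s ^ (1 / 2 : ℂ))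
        rw [phiRatio_conj _ _ hs, Complex.conj_cpow _ _
          (Complex.slitPlane_arg_ne_pi (phiRatio_mem_slitPlane h hs))]
        congr 2
        exact Complex.ext (by simp) (by simp)
      have := key _ hs' (by simpa using h0)
      rw [hconj, Complex.conj_im] at this
      linarith
  rw [Complex.mul_re]
  rcases le_total 0 s.re with h0 | h0
  · exact (min_le_left _ _).trans (by nlinarith [mul_nonneg h0 hre.le])
  · exact (min_le_right _ _).trans (by nlinarith [mul_le_mul_of_nonpos_right hle h0])

end Ratio

/-! ### Bounds up to the cut; rotation of a ray of integration -/

section CutBounds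
variable {μσ με : Measure ℝ} [IsFiniteMeasure μσ] [IsFiniteMeasure με]

lemma min_one_mul_le_mgf {μ : Measure ℝ} [IsFiniteMeasure μ] (hμ : μ (Icc (0 : ℝ) 1)ᶜ = 0)
    {r : ℝ} (hr : 0 < r) : min 1 r * μ.real univ ≤ mgf id μ (Real.log r) := by
  have hc : ∫ _ : ℝ, min 1 r ∂μ = min 1 r * μ.real univ := by
    rw [integral_const, smul_eq_mul, mul_comm]
  rw [← hc]
  refine integral_mono_ae (integrable_const _) (integrable_exp_mul_of_Icc hμ _) ?_
  have hμ' : ∀ᵐ x ∂μ, x ∈ Icc (0 : ℝ) 1 := hμ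
  filter_upwards [hμ'] with α hα
  simp only [id]
  rcases le_total r 1 with h | h
  · rw [min_eq_right h]
    conv_lhs => rw [← Real.exp_log hr]
    exact Real.exp_le_exp.2 (by nlinarith [Real.log_nonpos hr.le h, hα.2])
  · rw [min_eq_left h]
    exact Real.one_le_exp (mul_nonneg (Real.log_nonneg h) hα.1)

lemma mgf_le_one_add_mul {μ : Measure ℝ} [IsFiniteMeasure μ] (hμ : μ (Icc (0 : ℝ) 1)ᶜ = 0)
    {r : ℝ} (hr : 0 < r) : mgf id μ (Real.log r) ≤ (1 + r) * μ.real univ := by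
  have hc : ∫ _ : ℝ, (1 + r) ∂μ = (1 + r) * μ.real univ := by
    rw [integral_const, smul_eq_mul, mul_comm]
  rw [← hc]
  refine integral_mono_ae (integrable_exp_mul_of_Icc hμ _) (integrable_const _) ?_
  have hμ' : ∀ᵐ x ∂μ, x ∈ Icc (0 : ℝ) 1 := hμ
  filter_upwards [hμ'] with α hα
  simp only [id]
  rcases le_total r 1 with h | h
  · have : Real.exp (Real.log r * α) ≤ 1 :=
      Real.exp_le_one_iff.2 (mul_nonpos_of_nonpos_of_nonneg (Real.log_nonpos hr.le h) hα.1)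
    linarith
  · have : Real.exp (Real.log r * α) ≤ Real.exp (Real.log r) :=
      Real.exp_le_exp.2 (by nlinarith [Real.log_nonneg h, hα.2])
    rw [Real.exp_log hr] at this
    linarith

/-- If `με` does not charge the open interval, it is a multiple of the Dirac mass at `1`. -/
lemma Phi_ε_of_Ioo_eq_zero (h : Admissible μσ με) (h0 : με (Ioo 0 1) = 0) (s : ℂ) :
    Phi με s = με.real univ * s := by
  have hσ0 : μσ (Ioo 0 1) ≠ 0 := by
    obtain ⟨x, hx | hx, hx'⟩ := h.proper
    · exact ((Measure.mem_support_iff_forall x).1 hx _ (isOpen_Ioo.mem_nhds hx')).ne'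
    · exact absurd h0 ((Measure.mem_support_iff_forall x).1 hx _ (isOpen_Ioo.mem_nhds hx')).ne'
  have hz : με {0} = 0 := by
    have := h.thermo (Ioo 0 1 ×ˢ {0}) (measurableSet_Ioo.prod (measurableSet_singleton _)) ?_
    · rw [Measure.prod_prod, Measure.prod_prod, h0, zero_mul, nonpos_iff_eq_zero,
        mul_eq_zero] at this
      exact this.resolve_left hσ0
    · rintro ⟨x, y⟩ ⟨hx, hy⟩
      have hy' : y = 0 := hy
      subst hy'
      exact ⟨⟨hx.1.le, hx.2.le⟩, by simp, hx.1⟩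
  have hae : ∀ᵐ α ∂με, α = 1 := by
    have h1 : ∀ᵐ x ∂με, x ∈ Icc (0 : ℝ) 1 := h.ε_supp
    have h2 : ∀ᵐ x ∂με, x ∉ Ioo (0 : ℝ) 1 := measure_eq_zero_iff_ae_notMem.1 h0
    have h3 : ∀ᵐ x ∂με, x ∉ ({0} : Set ℝ) := measure_eq_zero_iff_ae_notMem.1 hz
    filter_upwards [h1, h2, h3] with α a1 a2 a3
    by_contra hc
    exact a2 ⟨lt_of_le_of_ne a1.1 (Ne.symm a3), lt_of_le_of_ne a1.2 hc⟩
  rw [Phi, integral_congr_ae (g := fun _ => s)]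
  · simp [integral_const]
  · filter_upwards [hae] with α hα
    simp [hα]

/-- A lower bound of `Φε` which is uniform up to the upper side of the cut. In the left half-plane it
comes from `Im Φε(s) = ∫ |s|^α sin (α arg s) dμε(α)`, unless `με` does not charge `(0, 1)`. -/
lemma exists_le_norm_Phi_ε (h : Admissible μσ με) :
    ∃ c : ℝ, 0 < c ∧ ∀ s : ℂ, s ≠ 0 → 0 ≤ s.im → c * min 1 ‖s‖ ≤ ‖Phi με s‖ := by
  have hm : 0 < με.real univ := by
    rw [measureReal_def]
    exact ENNReal.toReal_pos (by simpa using h.ε_ne) (measure_ne_top _ _)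
  by_cases h0 : με (Ioo 0 1) = 0
  · refine ⟨με.real univ, hm, fun s hs _ => ?_⟩
    rw [Phi_ε_of_Ioo_eq_zero h h0, norm_mul, Complex.norm_real, Real.norm_of_nonneg hm.le]
    exact mul_le_mul_of_nonneg_left (min_le_right _ _) hm.le
  have hμ' : ∀ᵐ x ∂με, x ∈ Icc (0 : ℝ) 1 := h.ε_supp
  have hsin : ∀ α ∈ Icc (0 : ℝ) 1, 0 ≤ Real.sin (α * Real.pi) := fun α hα =>
    Real.sin_nonneg_of_nonneg_of_le_pi (mul_nonneg hα.1 Real.pi_pos.le)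
      (by nlinarith [Real.pi_pos, hα.2])
  have hisin : Integrable (fun α : ℝ => Real.sin (α * Real.pi)) με :=
    Integrable.of_bound (by fun_prop) 1 (ae_of_all _ fun α => Real.abs_sin_le_one _)
  set d : ℝ := ∫ α, Real.sin (α * Real.pi) ∂με with hd
  have hdpos : 0 < d := by
    rw [hd, integral_pos_iff_support_of_nonneg_ae (hμ'.mono hsin) hisin]
    refine lt_of_lt_of_le (pos_iff_ne_zero.2 h0) (measure_mono fun α hα => ?_)
    exact (Real.sin_pos_of_pos_of_lt_pi (mul_pos hα.1 Real.pi_pos)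
      (by nlinarith [Real.pi_pos, hα.2])).ne'
  refine ⟨min (με.real univ / 2) (d / 2), lt_min (by linarith) (by linarith), fun s hs him => ?_⟩
  have hr : 0 < ‖s‖ := norm_pos_iff.2 hs
  have hmin : 0 < min 1 ‖s‖ := lt_min one_pos hr
  rcases le_total 0 s.re with hre | hre
  · have h1 := half_le_cos_arg_half hs (by linarith)
    have h2 := cos_mul_mgf_le_norm_Phi h.ε_supp hs
    have h3 := min_one_mul_le_mgf h.ε_supp hr
    have h4 := mgf_pos_of_Icc h.ε_supp h.ε_ne (Real.log ‖s‖)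
    calc _ ≤ με.real univ / 2 * min 1 ‖s‖ := mul_le_mul_of_nonneg_right (min_le_left _ _) hmin.le
      _ ≤ 1 / 2 * mgf id με (Real.log ‖s‖) := by linarith
      _ ≤ _ := (mul_le_mul_of_nonneg_right h1 h4.le).trans h2
  · have harg : s.arg ∈ Icc (Real.pi / 2) Real.pi := by
      refine ⟨?_, Complex.arg_le_pi s⟩
      by_contra! hc
      have h1 : 0 ≤ s.arg := Complex.arg_nonneg_iff.2 him
      have h2 := Real.cos_pos_of_mem_Ioo ⟨by linarith [Real.pi_pos], hc⟩
      rw [Complex.cos_arg hs] at h2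
      exact absurd (div_nonpos_of_nonpos_of_nonneg hre hr.le) (not_le.2 h2)
    have hIm : (Phi με s).im =
        ∫ α, Real.exp (Real.log ‖s‖ * α) * Real.sin (α * s.arg) ∂με := by
      have him' := Complex.imCLM.integral_comp_comm
        (integrable_cexp_mul_of_Icc h.ε_supp (Complex.log s))
      simp only [Complex.imCLM_apply] at him'
      rw [Phi_eq_complexMGF _ hs, complexMGF]
      simp only [id]
      rw [← him']
      congr 1
      ext α
      rw [Complex.exp_im, Complex.re_mul_ofReal, Complex.im_mul_ofReal, Complex.log_re,
        Complex.log_im, mul_comm s.arg]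
    have hkey : min 1 ‖s‖ * (d / 2) ≤ (Phi με s).im := by
      have hc : ∫ α, min 1 ‖s‖ / 2 * Real.sin (α * Real.pi) ∂με = min 1 ‖s‖ * (d / 2) := by
        rw [integral_const_mul, ← hd]
        ring
      rw [hIm, ← hc]
      refine integral_mono_ae (hisin.const_mul _) ?_ ?_
      · refine (integrable_exp_mul_of_Icc h.ε_supp (Real.log ‖s‖)).mono' (by fun_prop)
          (ae_of_all _ fun α => ?_)
        rw [norm_mul, Real.norm_eq_abs, Real.abs_exp]
        exact mul_le_of_le_one_right (Real.exp_pos _).le (Real.abs_sin_le_one _)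
      · filter_upwards [hμ'] with α hα
        -- `sin` is concave on `[0, π]`, so its minimum over `α * arg s` is at an end point
        have hs1 : min (Real.sin (α * (Real.pi / 2))) (Real.sin (α * Real.pi)) ≤
            Real.sin (α * s.arg) := by
          have hα1 : ∀ t ∈ Icc (0 : ℝ) Real.pi, α * t ∈ Icc (0 : ℝ) Real.pi := fun t ht =>
            ⟨mul_nonneg hα.1 ht.1, by nlinarith [ht.1, ht.2, hα.2]⟩
          refine strictConcaveOn_sin_Icc.concaveOn.min_le_of_mem_Icc (hα1 _ ?_) (hα1 _ ?_) ?_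
          · constructor <;> linarith [Real.pi_pos]
          · constructor <;> linarith [Real.pi_pos]
          · exact ⟨mul_le_mul_of_nonneg_left harg.1 hα.1, mul_le_mul_of_nonneg_left harg.2 hα.1⟩
        have hs2 : Real.sin (α * Real.pi) / 2 ≤ Real.sin (α * (Real.pi / 2)) := by
          have e : Real.sin (α * Real.pi) = 2 * Real.sin (α * (Real.pi / 2)) *
              Real.cos (α * (Real.pi / 2)) := by
            rw [← Real.sin_two_mul]
            congr 1
            ring
          have hp : 0 ≤ Real.sin (α * (Real.pi / 2)) :=
            Real.sin_nonneg_of_nonneg_of_le_pi (by nlinarith [Real.pi_pos, hα.1])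
              (by nlinarith [Real.pi_pos, hα.2])
          nlinarith [Real.cos_le_one (α * (Real.pi / 2))]
        have hs3 : Real.sin (α * Real.pi) / 2 ≤ Real.sin (α * s.arg) :=
          (le_min hs2 (by linarith [hsin α hα])).trans hs1
        have hexp : min 1 ‖s‖ ≤ Real.exp (Real.log ‖s‖ * α) := by
          rcases le_total ‖s‖ 1 with h' | h'
          · rw [min_eq_right h']
            conv_lhs => rw [← Real.exp_log hr]
            exact Real.exp_le_exp.2 (by nlinarith [Real.log_nonpos hr.le h', hα.2])
          · rw [min_eq_left h']
            exact Real.one_le_exp (mul_nonneg (Real.log_nonneg h') hα.1)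
        change min 1 ‖s‖ / 2 * Real.sin (α * Real.pi) ≤
          Real.exp (Real.log ‖s‖ * α) * Real.sin (α * s.arg)
        calc _ = min 1 ‖s‖ * (Real.sin (α * Real.pi) / 2) := by ring
          _ ≤ _ := mul_le_mul hexp hs3 (by linarith [hsin α hα]) (Real.exp_pos _).le
    calc _ ≤ d / 2 * min 1 ‖s‖ := mul_le_mul_of_nonneg_right (min_le_right _ _) hmin.le
      _ ≤ (Phi με s).im := by linarith
      _ ≤ _ := Complex.im_le_norm _

lemma exists_norm_mul_phiRatio_le (h : Admissible μσ με) :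
    ∃ C : ℝ, 0 ≤ C ∧ ∀ s : ℂ, s ≠ 0 → 0 ≤ s.im →
      ‖s * phiRatio μσ με s‖ ≤ C * (1 + ‖s‖) ^ 2 := by
  obtain ⟨c, hc, hb⟩ := exists_le_norm_Phi_ε h
  refine ⟨μσ.real univ / c, by positivity, fun s hs him => ?_⟩
  have hr : 0 < ‖s‖ := norm_pos_iff.2 hs
  have hmin : 0 < min 1 ‖s‖ := lt_min one_pos hr
  have h1 := (norm_Phi_le μσ hs).trans (mgf_le_one_add_mul h.σ_supp hr)
  have h2 := hb s hs him
  have h3 : ‖s‖ ≤ (1 + ‖s‖) * min 1 ‖s‖ := by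
    rcases le_total ‖s‖ 1 with h' | h'
    · rw [min_eq_right h']; nlinarith
    · rw [min_eq_left h']; linarith
  have hm : 0 ≤ μσ.real univ := measureReal_nonneg
  rw [phiRatio, norm_mul, norm_div, ← mul_div_assoc, div_le_iff₀ (lt_of_lt_of_le (by positivity) h2)]
  calc ‖s‖ * ‖Phi μσ s‖ ≤ ((1 + ‖s‖) * min 1 ‖s‖) * ((1 + ‖s‖) * μσ.real univ) := by gcongr
    _ = μσ.real univ / c * (1 + ‖s‖) ^ 2 * (c * min 1 ‖s‖) := by field_simp
    _ ≤ _ := by gcongr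

end CutBounds

section Rays

lemma one_add_pow_le_exp (n : ℕ) {δ r : ℝ} (hδ : 0 < δ) (hr : 0 ≤ r) :
    (1 + r) ^ n ≤ n.factorial / δ ^ n * Real.exp δ * Real.exp (δ * r) := by
  have h := Real.pow_div_factorial_le_exp (x := δ * (1 + r)) (by positivity) n
  rw [div_le_iff₀ (by positivity), mul_pow] at h
  rw [mul_assoc, ← Real.exp_add, div_mul_eq_mul_div, le_div_iff₀ (by positivity)]
  calc (1 + r) ^ n * δ ^ n = δ ^ n * (1 + r) ^ n := mul_comm _ _
    _ ≤ _ := h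
    _ = _ := by rw [mul_comm]; congr 2; ring

lemma integral_exp_mul_comp_exp (g : ℝ → ℂ) :
    ∫ u : ℝ, Real.exp u • g (Real.exp u) = ∫ r in Ioi (0 : ℝ), g r := by
  have := integral_image_eq_integral_abs_deriv_smul (s := univ) (f := Real.exp) (f' := Real.exp)
    MeasurableSet.univ (fun x _ => (Real.hasDerivAt_exp x).hasDerivWithinAt)
    (Real.exp_injective.injOn) g
  rw [image_univ, Real.range_exp] at this
  rw [this, Measure.restrict_univ]
  simp only [Real.abs_exp]

lemma integrableOn_Ioi_of_norm_le {f : ℝ → ℂ} (hf : ContinuousOn f (Ioi 0)) {C : ℝ}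
    (hb : ∀ r > 0, ‖f r‖ ≤ C / (1 + r ^ 2)) : IntegrableOn f (Ioi 0) := by
  have hi : Integrable (fun r : ℝ => C / (1 + r ^ 2)) := by
    simpa [div_eq_mul_inv] using integrable_inv_one_add_sq.const_mul C
  refine hi.integrableOn.mono' (hf.aestronglyMeasurable measurableSet_Ioi) ?_
  exact (ae_restrict_mem measurableSet_Ioi).mono fun r hr => hb r hr

/-- Rotation of a ray of integration about its vertex. In the variable `w = log (s - a)` the
sector between the two rays is a strip, where Cauchy's theorem for rectangles applies. -/
lemma integral_ray_eq {F : ℂ → ℂ} {a : ℂ} {θ₁ θ₂ C : ℝ} (hθ : θ₁ ≤ θ₂)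
    (hF : ∀ r > 0, ∀ θ ∈ Icc θ₁ θ₂,
      DifferentiableAt ℂ F (a + (r : ℝ) * Complex.exp ((θ : ℝ) * Complex.I)))
    (hb : ∀ r > 0, ∀ θ ∈ Icc θ₁ θ₂,
      ‖F (a + (r : ℝ) * Complex.exp ((θ : ℝ) * Complex.I))‖ ≤ C / (1 + r ^ 2)) :
    ∫ r in Ioi (0 : ℝ), F (a + r * Complex.exp (θ₁ * Complex.I)) * Complex.exp (θ₁ * Complex.I) =
    ∫ r in Ioi (0 : ℝ), F (a + r * Complex.exp (θ₂ * Complex.I)) *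
      Complex.exp (θ₂ * Complex.I) := by
  have hC : 0 ≤ C := by
    have := (norm_nonneg _).trans (hb 1 one_pos θ₁ ⟨le_rfl, hθ⟩)
    rw [le_div_iff₀ (by norm_num)] at this
    linarith
  set f : ℂ → ℂ := fun w => F (a + Complex.exp w) * Complex.exp w with hf
  have hexp : ∀ u θ : ℝ, Complex.exp (u + θ * Complex.I) =
      (Real.exp u : ℝ) * Complex.exp (θ * Complex.I) := fun u θ => by
    rw [Complex.exp_add, Complex.ofReal_exp]
  have hfd : ∀ u : ℝ, ∀ θ ∈ Icc θ₁ θ₂, DifferentiableAt ℂ f (u + θ * Complex.I) := by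
    intro u θ hθ'
    have h1 := hF _ (Real.exp_pos u) θ hθ'
    rw [← hexp] at h1
    refine DifferentiableAt.mul ?_ Complex.differentiableAt_exp
    exact DifferentiableAt.comp (f := fun w => a + Complex.exp w) _ h1
      (Complex.differentiableAt_exp.const_add a)
  have hfb : ∀ u : ℝ, ∀ θ ∈ Icc θ₁ θ₂, ‖f (u + θ * Complex.I)‖ ≤ C * Real.exp (-|u|) := by
    intro u θ hθ'
    have h1 := hb _ (Real.exp_pos u) θ hθ'
    rw [← hexp] at h1
    have h2 : ‖Complex.exp (u + θ * Complex.I)‖ = Real.exp u := by simp [Complex.norm_exp]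
    rw [hf, norm_mul, h2]
    refine (mul_le_mul_of_nonneg_right h1 (Real.exp_pos u).le).trans ?_
    rw [div_mul_eq_mul_div, div_le_iff₀ (by positivity), mul_assoc]
    refine mul_le_mul_of_nonneg_left ?_ hC
    rcases le_total 0 u with h0 | h0
    · rw [abs_of_nonneg h0, Real.exp_neg]
      have := Real.exp_pos u
      field_simp
      linarith
    · rw [abs_of_nonpos h0, neg_neg]
      nlinarith [Real.exp_pos u, sq_nonneg (Real.exp u)]
  have hint : ∀ θ ∈ Icc θ₁ θ₂, Integrable (fun u : ℝ => f (u + θ * Complex.I)) := by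
    intro θ hθ'
    have hcont : Continuous (fun u : ℝ => f (u + θ * Complex.I)) :=
      continuous_iff_continuousAt.2 fun u =>
        ContinuousAt.comp (f := fun u : ℝ => (u : ℂ) + θ * Complex.I) (hfd u θ hθ').continuousAt
          (by fun_prop)
    have hi : Integrable (fun u : ℝ => C * Real.exp (-|u|)) := by
      refine Integrable.const_mul ?_ C
      refine (integrable_inv_one_add_sq.const_mul 2).mono' (by fun_prop) (ae_of_all _ fun u => ?_)
      have h1 := Real.quadratic_le_exp_of_nonneg (abs_nonneg u)
      rw [sq_abs] at h1
      rw [Real.norm_eq_abs, Real.abs_exp, Real.exp_neg, ← div_eq_mul_inv,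
        inv_le_comm₀ (Real.exp_pos _) (by positivity), inv_div]
      linarith [abs_nonneg u]
    exact hi.mono' hcont.aestronglyMeasurable (ae_of_all _ fun u => hfb u θ hθ')
  have hray : ∀ θ ∈ Icc θ₁ θ₂, ∫ u : ℝ, f (u + θ * Complex.I) =
      ∫ r in Ioi (0 : ℝ), F (a + r * Complex.exp (θ * Complex.I)) *
        Complex.exp (θ * Complex.I) := by
    intro θ _
    rw [← integral_exp_mul_comp_exp]
    congr 1
    ext u
    rw [hf]
    simp only [hexp]
    rw [Complex.real_smul]
    ring
  have m1 : θ₁ ∈ Icc θ₁ θ₂ := ⟨le_rfl, hθ⟩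
  have m2 : θ₂ ∈ Icc θ₁ θ₂ := ⟨hθ, le_rfl⟩
  rw [← hray θ₁ m1, ← hray θ₂ m2]
  have hlim : ∀ θ ∈ Icc θ₁ θ₂, Tendsto (fun n : ℕ => ∫ u in (-(n : ℝ))..n, f (u + θ * Complex.I))
      atTop (𝓝 (∫ u : ℝ, f (u + θ * Complex.I))) := fun θ hθ' =>
    intervalIntegral_tendsto_integral (hint θ hθ')
      (tendsto_neg_atTop_atBot.comp tendsto_natCast_atTop_atTop) tendsto_natCast_atTop_atTop
  have hside : ∀ ε : ℝ, |ε| = 1 →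
      Tendsto (fun n : ℕ => ∫ y in θ₁..θ₂, f ((ε * n : ℝ) + y * Complex.I)) atTop (𝓝 0) := by
    intro ε hε
    have hz : Tendsto (fun n : ℕ => C * Real.exp (-(n : ℝ)) * |θ₂ - θ₁|) atTop (𝓝 0) := by
      have : Tendsto (fun n : ℕ => Real.exp (-(n : ℝ))) atTop (𝓝 0) :=
        Real.tendsto_exp_neg_atTop_nhds_zero.comp tendsto_natCast_atTop_atTop
      simpa using (this.const_mul C).mul_const |θ₂ - θ₁|
    refine squeeze_zero_norm (fun n => ?_) hz
    refine intervalIntegral.norm_integral_le_of_norm_le_const fun y hy => ?_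
    rw [uIoc_of_le hθ] at hy
    have := hfb (ε * n) y ⟨hy.1.le, hy.2⟩
    rwa [abs_mul, hε, one_mul, Nat.abs_cast] at this
  have hrect : ∀ n : ℕ, (∫ u in (-(n : ℝ))..n, f (u + θ₁ * Complex.I)) -
      (∫ u in (-(n : ℝ))..n, f (u + θ₂ * Complex.I)) +
      Complex.I • (∫ y in θ₁..θ₂, f ((1 * n : ℝ) + y * Complex.I)) -
      Complex.I • (∫ y in θ₁..θ₂, f ((-1 * n : ℝ) + y * Complex.I)) = 0 := by
    intro n
    have := Complex.integral_boundary_rect_eq_zero_of_differentiableOn f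
      ⟨-(n : ℝ), θ₁⟩ ⟨n, θ₂⟩ ?_
    · simpa using this
    · intro w hw
      have hw2 : w.im ∈ Icc θ₁ θ₂ := by
        have := hw.2
        simpa [uIcc_of_le hθ] using this
      have := hfd w.re w.im hw2
      rw [Complex.re_add_im] at this
      exact this.differentiableWithinAt
  have hL := (((hlim θ₁ m1).sub (hlim θ₂ m2)).add ((hside 1 (by simp)).const_smul Complex.I)).sub
    ((hside (-1) (by simp)).const_smul Complex.I)
  simp only [hrect, smul_zero, add_zero, sub_zero] at hL
  exact (sub_eq_zero.1 (tendsto_nhds_unique hL tendsto_const_nhds))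

end Rays

/-! ### Laplace-type integrals over two rays -/

section ExpIntegral

/-- The real-linear form `(ξ, t) ↦ ξ p + t q`. -/
noncomputable def linForm (p q : ℂ) : ℝ × ℝ →L[ℝ] ℂ :=
  (ContinuousLinearMap.fst ℝ ℝ ℝ).smulRight p + (ContinuousLinearMap.snd ℝ ℝ ℝ).smulRight q

lemma linForm_apply (p q : ℂ) (z : ℝ × ℝ) : linForm p q z = z.1 * p + z.2 * q := by
  simp [linForm]

lemma norm_linForm_le (p q : ℂ) : ‖linForm p q‖ ≤ ‖p‖ + ‖q‖ := by
  refine ContinuousLinearMap.opNorm_le_bound _ (by positivity) fun z => ?_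
  rw [linForm_apply]
  refine (norm_add_le _ _).trans ?_
  rw [norm_mul, norm_mul, Complex.norm_real, Complex.norm_real, add_mul, mul_comm ‖z.1‖,
    mul_comm ‖z.2‖]
  gcongr
  · exact norm_fst_le z
  · exact norm_snd_le z

/-- The cone `4 P |ξ| < t`. -/
def cone (P : ℝ) : Set (ℝ × ℝ) := {z | 4 * P * |z.1| < z.2}

lemma isOpen_cone (P : ℝ) : IsOpen (cone P) :=
  isOpen_lt (by fun_prop) continuous_snd

/-- Growth conditions under which the integrals of `c r * exp (ξ p r + t q r)` over the half-line
converge absolutely in the cone `4 P |ξ| < t`. -/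
structure RayData (c p q : ℝ → ℂ) (A B P : ℝ) : Prop where
  cont_c : ContinuousOn c (Ioi 0)
  cont_p : ContinuousOn p (Ioi 0)
  cont_q : ContinuousOn q (Ioi 0)
  A_nonneg : 0 ≤ A
  P_nonneg : 0 ≤ P
  norm_c : ∀ r > 0, ‖c r‖ ≤ B
  norm_p : ∀ r > 0, ‖p r‖ ≤ P * (1 + r)
  norm_q : ∀ r > 0, ‖q r‖ ≤ P * (1 + r)
  re_q : ∀ r > 0, (q r).re ≤ A - r / 2

variable {c p q : ℝ → ℂ} {A B P : ℝ}

lemma pos_of_mem_cone (hP : 0 ≤ P) {z : ℝ × ℝ} (hz : z ∈ cone P) : 0 < z.2 :=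
  lt_of_le_of_lt (by positivity) hz

lemma RayData.norm_exp_le (h : RayData c p q A B P) {z : ℝ × ℝ} (hz : z ∈ cone P) {r : ℝ}
    (hr : 0 < r) : ‖Complex.exp (linForm (p r) (q r) z)‖ ≤
      Real.exp (z.2 * (A + 1 / 4)) * Real.exp (-(z.2 / 4) * r) := by
  rw [Complex.norm_exp, ← Real.exp_add, linForm_apply]
  refine Real.exp_le_exp.2 ?_
  have hz2 := pos_of_mem_cone h.P_nonneg hz
  have hz' : 4 * P * |z.1| < z.2 := hz
  have h1 : z.1 * (p r).re ≤ |z.1| * (P * (1 + r)) := by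
    refine (le_abs_self _).trans ?_
    rw [abs_mul]
    exact mul_le_mul_of_nonneg_left ((Complex.abs_re_le_norm _).trans (h.norm_p r hr))
      (abs_nonneg _)
  have h2 : z.2 * (q r).re ≤ z.2 * (A - r / 2) := mul_le_mul_of_nonneg_left (h.re_q r hr) hz2.le
  have h3 : |z.1| * (P * (1 + r)) ≤ z.2 / 4 * (1 + r) := by
    rw [← mul_assoc]
    exact mul_le_mul_of_nonneg_right (by linarith) (by linarith)
  simp only [Complex.add_re, Complex.re_ofReal_mul]
  linarith

/-- A domination of the integrand and of its derivative near a point of the cone. -/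
lemma RayData.exists_bound (h : RayData c p q A B P) {z₀ : ℝ × ℝ} (hz₀ : z₀ ∈ cone P) :
    ∃ W ∈ 𝓝 z₀, ∃ C : ℝ, ∀ z ∈ W, z ∈ cone P ∧ ∀ r > 0,
      ‖c r * Complex.exp (linForm (p r) (q r) z)‖ ≤ C / (1 + r ^ 2) ∧
      ‖(c r * Complex.exp (linForm (p r) (q r) z)) • linForm (p r) (q r)‖ ≤ C / (1 + r ^ 2) := by
  have hz2 := pos_of_mem_cone h.P_nonneg hz₀
  have hP := h.P_nonneg
  have hA := h.A_nonneg
  have hB : 0 ≤ B := (norm_nonneg _).trans (h.norm_c 1 one_pos)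
  -- half of the decay rate `z.2 / 4` at `z₀`, so that it serves on a whole neighbourhood
  set δ : ℝ := z₀.2 / 8 with hδ
  have hδ0 : 0 < δ := by positivity
  set E : ℝ := Real.exp ((z₀.2 + 1) * (A + 1 / 4)) with hE
  set Kc : ℝ := (Nat.factorial 3 : ℝ) / δ ^ 3 * Real.exp δ with hKc
  refine ⟨cone P ∩ {z | z₀.2 / 2 < z.2 ∧ z.2 < z₀.2 + 1}, ?_, B * (E * Kc) * (2 * P + 1), ?_⟩
  · refine ((isOpen_cone P).inter ?_).mem_nhds ⟨hz₀, by constructor <;> linarith⟩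
    exact (isOpen_lt continuous_const continuous_snd).inter
      (isOpen_lt continuous_snd continuous_const)
  rintro z ⟨hz, hz3, hz4⟩
  refine ⟨hz, fun r hr => ?_⟩
  have he : ‖Complex.exp (linForm (p r) (q r) z)‖ ≤ E * Real.exp (-(δ * r)) := by
    refine (h.norm_exp_le hz hr).trans (mul_le_mul ?_ ?_ (Real.exp_pos _).le (Real.exp_pos _).le)
    · exact Real.exp_le_exp.2 (mul_le_mul_of_nonneg_right hz4.le (by linarith))
    · refine Real.exp_le_exp.2 ?_
      have : δ ≤ z.2 / 4 := by rw [hδ]; linarith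
      nlinarith
  have hK : Real.exp (-(δ * r)) * (1 + r) ≤ Kc / (1 + r ^ 2) := by
    have h1 := one_add_pow_le_exp 3 hδ0 hr.le
    rw [le_div_iff₀ (by positivity), Real.exp_neg, inv_mul_eq_div, div_mul_eq_mul_div,
      div_le_iff₀ (Real.exp_pos _)]
    refine le_trans ?_ h1
    nlinarith [mul_pos hr hr]
  have hlin : ‖linForm (p r) (q r)‖ ≤ 2 * P * (1 + r) :=
    (norm_linForm_le _ _).trans (by linarith [h.norm_p r hr, h.norm_q r hr])
  have hc1 : ‖c r * Complex.exp (linForm (p r) (q r) z)‖ ≤ B * (E * Real.exp (-(δ * r))) := by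
    rw [norm_mul]
    exact mul_le_mul (h.norm_c r hr) he (norm_nonneg _) hB
  have hEr := Real.exp_pos (-(δ * r))
  have hE0 : 0 < E := Real.exp_pos _
  constructor
  · refine hc1.trans ?_
    calc B * (E * Real.exp (-(δ * r))) ≤
          B * E * (Real.exp (-(δ * r)) * (1 + r)) * (2 * P + 1) := by
          have h5 : Real.exp (-(δ * r)) ≤ Real.exp (-(δ * r)) * (1 + r) * (2 * P + 1) := by
            rw [mul_assoc]
            exact le_mul_of_one_le_right hEr.le (by nlinarith)
          calc _ = B * E * Real.exp (-(δ * r)) := by ring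
            _ ≤ B * E * (Real.exp (-(δ * r)) * (1 + r) * (2 * P + 1)) := by gcongr
            _ = _ := by ring
      _ ≤ B * E * (Kc / (1 + r ^ 2)) * (2 * P + 1) := by gcongr
      _ = _ := by ring
  · rw [norm_smul]
    calc _ ≤ B * (E * Real.exp (-(δ * r))) * (2 * P * (1 + r)) := by gcongr
      _ = B * E * (Real.exp (-(δ * r)) * (1 + r)) * (2 * P) := by ring
      _ ≤ B * E * (Kc / (1 + r ^ 2)) * (2 * P + 1) := by
        have : 0 ≤ Kc := by positivity
        gcongr
        linarith
      _ = _ := by ring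

lemma RayData.continuousOn_integrand (h : RayData c p q A B P) (z : ℝ × ℝ) :
    ContinuousOn (fun r => c r * Complex.exp (linForm (p r) (q r) z)) (Ioi 0) := by
  simp only [linForm_apply]
  have := h.cont_c
  have := h.cont_p
  have := h.cont_q
  fun_prop

lemma RayData.continuousOn_linForm (h : RayData c p q A B P) :
    ContinuousOn (fun r => linForm (p r) (q r)) (Ioi 0) := by
  unfold linForm
  have h1 := h.cont_p
  have h2 := h.cont_q
  exact ((ContinuousLinearMap.smulRightL ℝ (ℝ × ℝ) ℂ
    (ContinuousLinearMap.fst ℝ ℝ ℝ)).continuous.comp_continuousOn h1).add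
    ((ContinuousLinearMap.smulRightL ℝ (ℝ × ℝ) ℂ
    (ContinuousLinearMap.snd ℝ ℝ ℝ)).continuous.comp_continuousOn h2)

lemma integrable_const_div_one_add_sq (C : ℝ) : Integrable (fun r : ℝ => C / (1 + r ^ 2)) := by
  simpa [div_eq_mul_inv] using integrable_inv_one_add_sq.const_mul C

lemma RayData.integrableOn (h : RayData c p q A B P) {z : ℝ × ℝ} (hz : z ∈ cone P) :
    IntegrableOn (fun r => c r * Complex.exp (linForm (p r) (q r) z)) (Ioi 0) := by
  obtain ⟨W, hW, C, hb⟩ := h.exists_bound hz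
  exact integrableOn_Ioi_of_norm_le (h.continuousOn_integrand z)
    fun r hr => ((hb z (mem_of_mem_nhds hW)).2 r hr).1

lemma RayData.integrableOn_fderiv (h : RayData c p q A B P) {z : ℝ × ℝ} (hz : z ∈ cone P) :
    IntegrableOn (fun r => (c r * Complex.exp (linForm (p r) (q r) z)) • linForm (p r) (q r))
      (Ioi 0) := by
  obtain ⟨W, hW, C, hb⟩ := h.exists_bound hz
  exact (integrable_const_div_one_add_sq C).integrableOn.mono'
    (((h.continuousOn_integrand z).smul h.continuousOn_linForm).aestronglyMeasurable
      measurableSet_Ioi) ((ae_restrict_mem measurableSet_Ioi).mono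
      fun r hr => ((hb z (mem_of_mem_nhds hW)).2 r hr).2)

lemma RayData.hasFDerivAt (h : RayData c p q A B P) {z : ℝ × ℝ} (hz : z ∈ cone P) :
    HasFDerivAt (fun z => ∫ r in Ioi (0 : ℝ), c r * Complex.exp (linForm (p r) (q r) z))
      (∫ r in Ioi (0 : ℝ), (c r * Complex.exp (linForm (p r) (q r) z)) • linForm (p r) (q r))
      z := by
  obtain ⟨W, hW, C, hb⟩ := h.exists_bound hz
  refine hasFDerivAt_integral_of_dominated_of_fderiv_le (𝕜 := ℝ)
    (F' := fun z r => (c r * Complex.exp (linForm (p r) (q r) z)) • linForm (p r) (q r))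
    (bound := fun r => C / (1 + r ^ 2)) hW ?_ (h.integrableOn hz)
    (h.integrableOn_fderiv hz).aestronglyMeasurable ?_
    (integrable_const_div_one_add_sq C).integrableOn ?_
  · exact Eventually.of_forall fun z =>
      (h.continuousOn_integrand z).aestronglyMeasurable measurableSet_Ioi
  · exact (ae_restrict_mem measurableSet_Ioi).mono fun r hr z hz => ((hb z hz).2 r hr).2
  · refine ae_of_all _ fun r z _ => ?_
    have := ((linForm (p r) (q r)).hasFDerivAt (x := z)).cexp.const_mul (c r)
    rwa [smul_smul] at this

lemma RayData.continuousOn_fderiv (h : RayData c p q A B P) :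
    ContinuousOn (fun z => ∫ r in Ioi (0 : ℝ),
      (c r * Complex.exp (linForm (p r) (q r) z)) • linForm (p r) (q r)) (cone P) := by
  intro z hz
  refine ContinuousAt.continuousWithinAt ?_
  obtain ⟨W, hW, C, hb⟩ := h.exists_bound hz
  refine continuousAt_of_dominated (bound := fun r => C / (1 + r ^ 2)) ?_ ?_
    (integrable_const_div_one_add_sq C).integrableOn ?_
  · exact Eventually.of_forall fun z => ((h.continuousOn_integrand z).smul
      h.continuousOn_linForm).aestronglyMeasurable measurableSet_Ioi
  · filter_upwards [hW] with z hz
    exact (ae_restrict_mem measurableSet_Ioi).mono fun r hr => ((hb z hz).2 r hr).2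
  · exact ae_of_all _ fun r => by fun_prop

lemma RayData.integral_fderiv_apply (h : RayData c p q A B P) {z : ℝ × ℝ} (hz : z ∈ cone P) :
    (∫ r in Ioi (0 : ℝ), (c r * Complex.exp (linForm (p r) (q r) z)) • linForm (p r) (q r)) (1, 0) =
      ∫ r in Ioi (0 : ℝ), c r * Complex.exp (linForm (p r) (q r) z) * p r := by
  rw [ContinuousLinearMap.integral_apply (h.integrableOn_fderiv hz)]
  congr 1
  ext r
  rw [smul_apply, linForm_apply (p r) (q r) (1, 0)]
  simp

end ExpIntegral

section Contour

/-- The ray `a + r e^{iθ}`. -/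
noncomputable def ray (a θ r : ℝ) : ℂ := a + r * Complex.exp (θ * Complex.I)

lemma ray_re (a θ r : ℝ) : (ray a θ r).re = a + r * Real.cos θ := by
  simp [ray, Complex.exp_ofReal_mul_I_re]

lemma ray_im (a θ r : ℝ) : (ray a θ r).im = r * Real.sin θ := by
  simp [ray, Complex.exp_ofReal_mul_I_im]

lemma continuous_ray (a θ : ℝ) : Continuous (ray a θ) := by
  unfold ray
  fun_prop

lemma ray_neg (a θ r : ℝ) : ray a (-θ) r = (starRingEnd ℂ) (ray a θ r) := by
  apply Complex.ext
  · simp [ray_re]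
  · simp [ray_im]

lemma norm_ray_le {a θ r : ℝ} (ha : 0 < a) (hr : 0 < r) : ‖ray a θ r‖ ≤ a + r := by
  refine (norm_add_le _ _).trans ?_
  rw [norm_mul, Complex.norm_exp_ofReal_mul_I, mul_one, Complex.norm_real, Complex.norm_real,
    Real.norm_of_nonneg ha.le, Real.norm_of_nonneg hr.le]

lemma neg_half_le_cos {θ : ℝ} (hθ : |θ| ≤ 2 * Real.pi / 3) : -(1 / 2) ≤ Real.cos θ := by
  rw [← Real.cos_abs]
  have h1 : Real.cos (2 * Real.pi / 3) = -(1 / 2) := by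
    rw [show 2 * Real.pi / 3 = Real.pi - Real.pi / 3 by ring, Real.cos_pi_sub, Real.cos_pi_div_three]
  rw [← h1]
  exact Real.cos_le_cos_of_nonneg_of_le_pi (abs_nonneg _) (by linarith [Real.pi_pos]) hθ

lemma sq_add_sq_le_norm_ray_sq {a θ r : ℝ} (ha : 0 < a) (hr : 0 < r)
    (hθ : |θ| ≤ 2 * Real.pi / 3) : (a ^ 2 + r ^ 2) / 2 ≤ ‖ray a θ r‖ ^ 2 := by
  rw [← Complex.normSq_eq_norm_sq, Complex.normSq_apply, ray_re, ray_im]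
  have h1 := neg_half_le_cos hθ
  have h2 := Real.sin_sq_add_cos_sq θ
  have h3 : (a + r * Real.cos θ) * (a + r * Real.cos θ) + r * Real.sin θ * (r * Real.sin θ) =
      a ^ 2 + 2 * (a * r) * Real.cos θ + r ^ 2 * (Real.sin θ ^ 2 + Real.cos θ ^ 2) := by ring
  rw [h3, h2]
  nlinarith [mul_pos ha hr, sq_nonneg (a - r)]

lemma ray_mem_outerSector {a θ r : ℝ} (ha : 0 < a) (hr : 0 < r) (hθ : |θ| ≤ 2 * Real.pi / 3) :
    ray a θ r ∈ outerSector a := by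
  constructor
  · have h1 := sq_add_sq_le_norm_ray_sq ha hr hθ
    refine abs_le_of_sq_le_sq' ?_ (norm_nonneg _) |>.2
    nlinarith [sq_nonneg r, sq_nonneg a]
  · have h1 := neg_half_le_cos hθ
    have h2 : r - a ≤ ‖ray a θ r‖ := by
      have := norm_sub_norm_le ((r : ℂ) * Complex.exp (θ * Complex.I)) (-(a : ℂ))
      rw [sub_neg_eq_add, norm_neg, norm_mul, Complex.norm_exp_ofReal_mul_I, mul_one,
        Complex.norm_real, Complex.norm_real, Real.norm_of_nonneg ha.le,
        Real.norm_of_nonneg hr.le, add_comm] at this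
      exact this
    rw [ray_re]
    nlinarith

lemma ray_mem_slitPlane {a θ r : ℝ} (ha : 0 < a) (hr : 0 < r) (hθ : |θ| ≤ 2 * Real.pi / 3) :
    ray a θ r ∈ Complex.slitPlane :=
  outerSector_subset_slitPlane ha (ray_mem_outerSector ha hr hθ)

/-- The integral of `F` along the ray from `a` in direction `e^{iθ}`. -/
noncomputable def rayIntegral (F : ℂ → ℂ) (a θ : ℝ) : ℂ :=
  ∫ r in Ioi (0 : ℝ), F (ray a θ r) * Complex.exp (θ * Complex.I)

/-- The Bromwich integral of `F` over the contour formed by the rays from `a` in the directions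
`e^{-iθ}` (inwards) and `e^{iθ}` (outwards); for `θ = π / 2` it is the vertical line. -/
noncomputable def bromwich (F : ℂ → ℂ) (a θ : ℝ) : ℂ :=
  1 / (2 * Real.pi * Complex.I) * (rayIntegral F a θ - rayIntegral F a (-θ))

lemma rayIntegral_eq {F : ℂ → ℂ} {a θ₁ θ₂ C : ℝ} (hθ : θ₁ ≤ θ₂)
    (hF : ∀ r > 0, ∀ θ ∈ Icc θ₁ θ₂, DifferentiableAt ℂ F (ray a θ r))
    (hb : ∀ r > 0, ∀ θ ∈ Icc θ₁ θ₂, ‖F (ray a θ r)‖ ≤ C / (1 + r ^ 2)) :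
    rayIntegral F a θ₁ = rayIntegral F a θ₂ :=
  integral_ray_eq hθ hF hb

variable {μσ με : Measure ℝ} [IsFiniteMeasure μσ] [IsFiniteMeasure με]

/-- The integrand `½ Ψ(s) exp (-ξ s Ψ(s) + s t)` of the inverse Laplace transform
defining `K`, where `ξ = |x|`. -/
noncomputable def waveKernel (μσ με : Measure ℝ) (ξ t : ℝ) (s : ℂ) : ℂ :=
  1 / 2 * Psi μσ με s * Complex.exp (-(ξ : ℂ) * s * Psi μσ με s + s * t)

/-- The profile of `K`, with `K(x, t) = waveProfile (|x|, t)`. Its defining integral converges also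
for small negative `ξ`, so that it is differentiable across `ξ = 0`. -/
noncomputable def waveProfile (μσ με : Measure ℝ) (a : ℝ) (z : ℝ × ℝ) : ℂ :=
  bromwich (waveKernel μσ με z.1 z.2) a (2 * Real.pi / 3)

/-- A common bound of `‖Ψ‖`, and of `‖s‖` and `‖s Ψ(s)‖` relative to `1 + r`, on the contours. -/
def IsContourBound (μσ με : Measure ℝ) (a P : ℝ) : Prop :=
  0 ≤ P ∧ (∀ s ∈ outerSector a, ‖Psi μσ με s‖ ≤ P) ∧ ∀ θ, |θ| ≤ 2 * Real.pi / 3 → ∀ r > 0,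
    ‖ray a θ r‖ ≤ P * (1 + r) ∧ ‖ray a θ r * Psi μσ με (ray a θ r)‖ ≤ P * (1 + r)

lemma exists_isContourBound (h : Admissible μσ με) {a : ℝ} (ha : 0 < a) :
    ∃ P, IsContourBound μσ με a P := by
  obtain ⟨C, hC, hb⟩ := exists_norm_Psi_le h ha
  refine ⟨(1 + a) * (1 + C), by positivity, fun s hs => ?_, fun θ hθ r hr => ?_⟩
  · refine (hb s hs).trans ?_
    nlinarith
  · have h1 : ‖ray a θ r‖ ≤ (1 + a) * (1 + r) :=
      (norm_ray_le ha hr).trans (by nlinarith)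
    have h2 := hb _ (ray_mem_outerSector ha hr hθ)
    constructor
    · refine h1.trans ?_
      have : 0 ≤ (1 + a) * (1 + r) * C := by positivity
      nlinarith
    · rw [norm_mul]
      calc _ ≤ (1 + a) * (1 + r) * (1 + C) := by
            gcongr
            linarith
        _ = _ := by ring

lemma rayData (h : Admissible μσ με) {a : ℝ} (ha : 0 < a) {P : ℝ}
    (hP : IsContourBound μσ με a P) {θ : ℝ} (hθ : |θ| = 2 * Real.pi / 3) :
    RayData (fun r => 1 / 2 * Psi μσ με (ray a θ r) * Complex.exp (θ * Complex.I))
      (fun r => -(ray a θ r * Psi μσ με (ray a θ r))) (ray a θ) a P P := by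
  have hΨ : ContinuousOn (fun r => Psi μσ με (ray a θ r)) (Ioi 0) := fun r hr =>
    (((differentiableAt_Psi h (ray_mem_slitPlane ha hr hθ.le)).continuousAt).comp
      (continuous_ray a θ).continuousAt).continuousWithinAt
  have hray : ContinuousOn (ray a θ) (Ioi 0) := (continuous_ray a θ).continuousOn
  have hcos : Real.cos θ = -(1 / 2) := by
    rw [← Real.cos_abs, hθ, show 2 * Real.pi / 3 = Real.pi - Real.pi / 3 by ring, Real.cos_pi_sub,
      Real.cos_pi_div_three]
  refine ⟨by fun_prop, by fun_prop, hray, ha.le, hP.1, fun r hr => ?_, fun r hr => ?_,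
    fun r hr => (hP.2.2 θ hθ.le r hr).1, fun r hr => ?_⟩
  · rw [norm_mul, norm_mul, Complex.norm_exp_ofReal_mul_I, mul_one]
    have := hP.2.1 _ (ray_mem_outerSector ha hr hθ.le)
    have h2 : ‖(1 / 2 : ℂ)‖ = 1 / 2 := by norm_num
    rw [h2]
    linarith [norm_nonneg (Psi μσ με (ray a θ r))]
  · rw [norm_neg]
    exact (hP.2.2 θ hθ.le r hr).2
  · rw [ray_re, hcos]
    linarith

lemma waveKernel_ray_mul (μσ με : Measure ℝ) (a θ r : ℝ) (z : ℝ × ℝ) :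
    waveKernel μσ με z.1 z.2 (ray a θ r) * Complex.exp (θ * Complex.I) =
      1 / 2 * Psi μσ με (ray a θ r) * Complex.exp (θ * Complex.I) *
        Complex.exp (linForm (-(ray a θ r * Psi μσ με (ray a θ r))) (ray a θ r) z) := by
  rw [waveKernel, linForm_apply]
  have : -(z.1 : ℂ) * ray a θ r * Psi μσ με (ray a θ r) + ray a θ r * z.2 =
      z.1 * -(ray a θ r * Psi μσ με (ray a θ r)) + z.2 * ray a θ r := by ring
  rw [this]
  ring

lemma abs_two_pi_div_three : |2 * Real.pi / 3| = 2 * Real.pi / 3 := abs_of_pos (by positivity)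

/-- The profile is continuously differentiable in the cone; its `ξ`-derivative at `ξ = 0` is the
Bromwich integral of `-½ s Ψ(s)² e^{st}`. -/
lemma waveProfile_regular (h : Admissible μσ με) {a : ℝ} (ha : 0 < a) {P : ℝ}
    (hP : IsContourBound μσ με a P) :
    ContDiffOn ℝ 1 (waveProfile μσ με a) (cone P) ∧
    ∀ t > 0, fderiv ℝ (waveProfile μσ με a) (0, t) (1, 0) =
      -(1 / 2) * bromwich (fun s => s * phiRatio μσ με s * Complex.exp (s * t)) a
        (2 * Real.pi / 3) := by
  set θ := 2 * Real.pi / 3 with hθdef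
  have d1 := rayData h ha hP (θ := θ) abs_two_pi_div_three
  have d2 := rayData h ha hP (θ := -θ) (by rw [abs_neg]; exact abs_two_pi_div_three)
  set κ : ℂ := 1 / (2 * Real.pi * Complex.I) with hκ
  have hprof : waveProfile μσ με a = fun z => κ * ((∫ r in Ioi (0 : ℝ),
        1 / 2 * Psi μσ με (ray a θ r) * Complex.exp (θ * Complex.I) *
        Complex.exp (linForm (-(ray a θ r * Psi μσ με (ray a θ r))) (ray a θ r) z)) -
      ∫ r in Ioi (0 : ℝ),
        1 / 2 * Psi μσ με (ray a (-θ) r) * Complex.exp ((-θ : ℝ) * Complex.I) *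
        Complex.exp (linForm (-(ray a (-θ) r * Psi μσ με (ray a (-θ) r))) (ray a (-θ) r) z)) := by
    funext z
    simp only [← waveKernel_ray_mul]
    rfl
  have hder : ∀ z ∈ cone P, HasFDerivAt (waveProfile μσ με a) _ z := fun z hz => by
    rw [hprof]
    exact (((d1.hasFDerivAt hz).sub (d2.hasFDerivAt hz)).const_mul κ)
  constructor
  · have h01 : (1 : WithTop ℕ∞) = 0 + 1 := by norm_num
    rw [h01, contDiffOn_succ_iff_fderiv_of_isOpen (isOpen_cone P)]
    refine ⟨fun z hz => (hder z hz).differentiableAt.differentiableWithinAt, by simp, ?_⟩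
    rw [contDiffOn_zero]
    refine ContinuousOn.congr ?_ fun z hz => (hder z hz).fderiv
    exact (d1.continuousOn_fderiv.sub d2.continuousOn_fderiv).const_smul κ
  · intro t ht
    have hz : ((0 : ℝ), t) ∈ cone P := by simpa [cone] using ht
    rw [(hder _ hz).fderiv, smul_apply, sub_apply,
      d1.integral_fderiv_apply hz, d2.integral_fderiv_apply hz, bromwich, rayIntegral, rayIntegral,
      ← hκ, smul_eq_mul, ← mul_assoc, mul_comm (-(1 / 2)) κ, mul_assoc, mul_sub (-(1 / 2) : ℂ),
      ← integral_const_mul, ← integral_const_mul]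
    congr 3
    all_goals
      ext r
      rw [← waveKernel_ray_mul, waveKernel, ← Psi_sq]
      simp only [Complex.ofReal_zero, neg_zero, zero_mul, zero_add]
      ring

end Contour

/-! ### The jump as an integral over the cut -/

section Jump
/-- `s Ψ(s)² e^{st}`: up to sign, `s Ψ(s)²` is the Laplace transform of the jump of `∂K/∂x`. -/
noncomputable def jumpKernel (μσ με : Measure ℝ) (t : ℝ) (s : ℂ) : ℂ :=
  s * phiRatio μσ με s * Complex.exp (s * t)

/-- The jump density on the cut, `-ρ e^{-ρ t} Im (Φσ/Φε)(-ρ)` for `ρ = r - a > 0`. -/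
noncomputable def jumpDensity (μσ με : Measure ℝ) (a t r : ℝ) : ℝ :=
  (jumpKernel μσ με t ((a - r : ℝ) : ℂ)).im

lemma jumpDensity_eq (μσ με : Measure ℝ) (a t r : ℝ) : jumpDensity μσ με a t r =
    (a - r) * (phiRatio μσ με ((a - r : ℝ) : ℂ)).im * Real.exp ((a - r) * t) := by
  rw [jumpDensity, jumpKernel, ← Complex.ofReal_mul, ← Complex.ofReal_exp, Complex.im_mul_ofReal,
    Complex.im_ofReal_mul]

lemma jumpDensity_of_lt (μσ με : Measure ℝ) {a t r : ℝ} (hr : r < a) : jumpDensity μσ με a t r = 0 := by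
  have hs : ((a - r : ℝ) : ℂ) ∈ Complex.slitPlane := by
    rw [Complex.ofReal_mem_slitPlane]
    linarith
  have h1 := phiRatio_conj μσ με hs
  rw [Complex.conj_ofReal] at h1
  rw [jumpDensity_eq, Complex.conj_eq_iff_im.1 h1.symm]
  ring

variable {μσ με : Measure ℝ} [IsFiniteMeasure μσ] [IsFiniteMeasure με]

/-- `phiRatio` extends continuously from the upper half-plane to the upper side of the cut. -/
lemma continuousWithinAt_phiRatio (h : Admissible μσ με) {s : ℂ} (hs : s ≠ 0) (him : 0 ≤ s.im) :
    ContinuousWithinAt (phiRatio μσ με) {z | 0 ≤ z.im} s := by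
  have hlog : ContinuousWithinAt Complex.log {z | 0 ≤ z.im} s := by
    by_cases hsl : s ∈ Complex.slitPlane
    · exact (Complex.differentiableAt_log hsl).continuousAt.continuousWithinAt
    · rw [Complex.mem_slitPlane_iff] at hsl
      push Not at hsl
      refine Complex.continuousWithinAt_log_of_re_neg_of_im_zero (lt_of_le_of_ne hsl.1 ?_) hsl.2
      exact fun h0 => hs (Complex.ext h0 hsl.2)
  have hPhi : ∀ μ : Measure ℝ, IsFiniteMeasure μ → μ (Icc (0 : ℝ) 1)ᶜ = 0 →
      ContinuousWithinAt (Phi μ) {z | 0 ≤ z.im} s := by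
    intro μ _ hμ
    have h1 : ContinuousWithinAt (fun z => complexMGF id μ (Complex.log z)) {z | 0 ≤ z.im} s :=
      (differentiable_complexMGF_of_Icc hμ).continuous.continuousAt.comp_continuousWithinAt hlog
    refine h1.congr_of_eventuallyEq ?_ (Phi_eq_complexMGF μ hs)
    filter_upwards [mem_nhdsWithin_of_mem_nhds (isOpen_ne.mem_nhds hs)] with z hz
    exact Phi_eq_complexMGF μ hz
  obtain ⟨c, hc, hb⟩ := exists_le_norm_Phi_ε h
  refine (hPhi _ inferInstance h.σ_supp).div (hPhi _ inferInstance h.ε_supp) ?_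
  have h1 := hb s hs him
  have h2 : 0 < c * min 1 ‖s‖ := mul_pos hc (lt_min one_pos (norm_pos_iff.2 hs))
  exact norm_pos_iff.1 (h2.trans_le h1)

lemma exists_norm_jumpKernel_ray_le (h : Admissible μσ με) {a t : ℝ} (ha : 0 < a) (ht : 0 < t) :
    ∃ C : ℝ, ∀ θ ∈ Ico (2 * Real.pi / 3) Real.pi, ∀ r > 0,
      ‖jumpKernel μσ με t (ray a θ r)‖ ≤ C / (1 + r ^ 2) := by
  obtain ⟨C, hC, hb⟩ := exists_norm_mul_phiRatio_le h
  set Kc : ℝ := (Nat.factorial 4 : ℝ) / (t / 2) ^ 4 * Real.exp (t / 2) with hKc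
  refine ⟨C * (1 + a) ^ 2 * Real.exp (t * a) * Kc, fun θ hθ r hr => ?_⟩
  have hpi := Real.pi_pos
  have hθ0 : 0 < θ := lt_of_lt_of_le (by positivity) hθ.1
  have him : 0 < (ray a θ r).im := by
    rw [ray_im]
    exact mul_pos hr (Real.sin_pos_of_pos_of_lt_pi hθ0 hθ.2)
  have hs0 : ray a θ r ≠ 0 := fun h0 => by simp [h0] at him
  have h1 := hb _ hs0 him.le
  have h2 := norm_ray_le (θ := θ) ha hr
  have hcos : Real.cos θ ≤ -(1 / 2) := by
    have e : Real.cos (2 * Real.pi / 3) = -(1 / 2) := by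
      rw [show 2 * Real.pi / 3 = Real.pi - Real.pi / 3 by ring, Real.cos_pi_sub,
        Real.cos_pi_div_three]
    rw [← e]
    exact Real.cos_le_cos_of_nonneg_of_le_pi (by positivity) hθ.2.le hθ.1
  have hre : (ray a θ r).re ≤ a - r / 2 := by
    rw [ray_re]
    nlinarith
  have he : ‖Complex.exp (ray a θ r * t)‖ ≤ Real.exp (t * a) * Real.exp (-(t / 2 * r)) := by
    rw [Complex.norm_exp, Complex.re_mul_ofReal, ← Real.exp_add]
    exact Real.exp_le_exp.2 (by nlinarith)
  have hK : (1 + r) ^ 2 * Real.exp (-(t / 2 * r)) ≤ Kc / (1 + r ^ 2) := by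
    have h1 := one_add_pow_le_exp 4 (half_pos ht) hr.le
    rw [le_div_iff₀ (by positivity), Real.exp_neg, ← div_eq_mul_inv, div_mul_eq_mul_div,
      div_le_iff₀ (Real.exp_pos _)]
    refine le_trans ?_ h1
    have : (1 + r) ^ 4 = (1 + r) ^ 2 * (1 + r) ^ 2 := by ring
    rw [this]
    refine mul_le_mul_of_nonneg_left ?_ (by positivity)
    nlinarith
  rw [jumpKernel, norm_mul]
  calc ‖ray a θ r * phiRatio μσ με (ray a θ r)‖ * ‖Complex.exp (ray a θ r * t)‖
      ≤ (C * (1 + (a + r)) ^ 2) * (Real.exp (t * a) * Real.exp (-(t / 2 * r))) := by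
        refine mul_le_mul (h1.trans ?_) he (norm_nonneg _) (by positivity)
        gcongr
    _ ≤ (C * ((1 + a) * (1 + r)) ^ 2) * (Real.exp (t * a) * Real.exp (-(t / 2 * r))) := by
        gcongr
        nlinarith
    _ = C * (1 + a) ^ 2 * Real.exp (t * a) * ((1 + r) ^ 2 * Real.exp (-(t / 2 * r))) := by ring
    _ ≤ C * (1 + a) ^ 2 * Real.exp (t * a) * (Kc / (1 + r ^ 2)) := by gcongr
    _ = _ := by ring

lemma ray_mem_slitPlane_of_mem_Ico {a θ r : ℝ} (hr : 0 < r)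
    (hθ : θ ∈ Ico (2 * Real.pi / 3) Real.pi) : ray a θ r ∈ Complex.slitPlane := by
  have hpi := Real.pi_pos
  have hθ0 : 0 < θ := lt_of_lt_of_le (by positivity) hθ.1
  refine Complex.mem_slitPlane_iff.2 (Or.inr ?_)
  rw [ray_im]
  exact (mul_pos hr (Real.sin_pos_of_pos_of_lt_pi hθ0 hθ.2)).ne'

lemma differentiableAt_jumpKernel (h : Admissible μσ με) (t : ℝ) {s : ℂ}
    (hs : s ∈ Complex.slitPlane) : DifferentiableAt ℂ (jumpKernel μσ με t) s := by
  have := differentiableAt_phiRatio h hs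
  unfold jumpKernel
  fun_prop

/-- Folding the upper ray onto the cut: the opening angle is increased to `π`, where the ray runs
back from `a` through the branch point along the upper side of the negative half-line. -/
lemma integrableOn_and_rayIntegral_jumpKernel (h : Admissible μσ με) {a t : ℝ} (ha : 0 < a)
    (ht : 0 < t) :
    IntegrableOn (fun r : ℝ => jumpKernel μσ με t ((a - r : ℝ) : ℂ)) (Ioi 0) ∧
    rayIntegral (jumpKernel μσ με t) a (2 * Real.pi / 3) =
      -∫ r in Ioi (0 : ℝ), jumpKernel μσ με t ((a - r : ℝ) : ℂ) := by
  obtain ⟨C, hb⟩ := exists_norm_jumpKernel_ray_le h ha ht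
  have hpi := Real.pi_pos
  have hmem : ∀ᶠ θ in 𝓝[<] Real.pi, θ ∈ Ico (2 * Real.pi / 3) Real.pi := by
    filter_upwards [self_mem_nhdsWithin,
      mem_nhdsWithin_of_mem_nhds (Ioi_mem_nhds (show 2 * Real.pi / 3 < Real.pi by linarith))]
      with θ h1 h2 using ⟨le_of_lt h2, h1⟩
  have hconst : ∀ᶠ θ in 𝓝[<] Real.pi, rayIntegral (jumpKernel μσ με t) a θ =
      rayIntegral (jumpKernel μσ με t) a (2 * Real.pi / 3) := by
    filter_upwards [hmem] with θ hθ
    refine (rayIntegral_eq hθ.1 (C := C) (fun r hr φ hφ => ?_) fun r hr φ hφ => ?_).symm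
    · exact differentiableAt_jumpKernel h t
        (ray_mem_slitPlane_of_mem_Ico hr ⟨hφ.1, hφ.2.trans_lt hθ.2⟩)
    · exact hb φ ⟨hφ.1, hφ.2.trans_lt hθ.2⟩ r hr
  have hptw : ∀ r ∈ Ioi (0 : ℝ), r ≠ a →
      Tendsto (fun θ => jumpKernel μσ με t (ray a θ r)) (𝓝[<] Real.pi)
        (𝓝 (jumpKernel μσ με t ((a - r : ℝ) : ℂ))) := by
    intro r hr hra
    have hs0 : ((a - r : ℝ) : ℂ) ≠ 0 := by
      rw [Complex.ofReal_ne_zero, sub_ne_zero]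
      exact hra.symm
    have hc : ContinuousWithinAt (jumpKernel μσ με t) {z | 0 ≤ z.im} ((a - r : ℝ) : ℂ) := by
      have := continuousWithinAt_phiRatio h hs0 (by simp)
      unfold jumpKernel
      exact (continuousWithinAt_id.mul this).mul (by fun_prop)
    have hrc : Tendsto (fun θ => ray a θ r) (𝓝[<] Real.pi) (𝓝 ((a - r : ℝ) : ℂ)) := by
      have h1 : Continuous (fun θ => ray a θ r) := by unfold ray; fun_prop
      have h2 : ray a Real.pi r = ((a - r : ℝ) : ℂ) := by
        rw [ray, Complex.exp_pi_mul_I]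
        push_cast
        ring
      rw [← h2]
      exact h1.continuousAt.tendsto.mono_left nhdsWithin_le_nhds
    refine hc.tendsto.comp (tendsto_nhdsWithin_iff.2 ⟨hrc, ?_⟩)
    filter_upwards [hmem] with θ hθ
    have hθ0 : 0 < θ := lt_of_lt_of_le (by positivity) hθ.1
    change 0 ≤ (ray a θ r).im
    rw [ray_im]
    exact mul_nonneg (le_of_lt hr) (Real.sin_nonneg_of_nonneg_of_le_pi hθ0.le hθ.2.le)
  have hne : ∀ᵐ r ∂(volume.restrict (Ioi (0 : ℝ))), r ≠ a :=
    ae_restrict_of_ae (Measure.ae_ne volume a)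
  have hmeas : ∀ θ ∈ Ico (2 * Real.pi / 3) Real.pi,
      AEStronglyMeasurable (fun r => jumpKernel μσ με t (ray a θ r))
        (volume.restrict (Ioi (0 : ℝ))) := by
    intro θ hθ
    refine ContinuousOn.aestronglyMeasurable (fun r hr => ?_) measurableSet_Ioi
    exact ((differentiableAt_jumpKernel h t
      (ray_mem_slitPlane_of_mem_Ico hr hθ)).continuousAt.comp
        (continuous_ray a θ).continuousAt).continuousWithinAt
  have hptw' : ∀ᵐ r ∂(volume.restrict (Ioi (0 : ℝ))),
      Tendsto (fun θ => jumpKernel μσ με t (ray a θ r)) (𝓝[<] Real.pi)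
        (𝓝 (jumpKernel μσ με t ((a - r : ℝ) : ℂ))) := by
    filter_upwards [hne, ae_restrict_mem measurableSet_Ioi] with r h1 h2 using hptw r h2 h1
  have hint : IntegrableOn (fun r : ℝ => jumpKernel μσ με t ((a - r : ℝ) : ℂ)) (Ioi 0) := by
    refine (integrable_const_div_one_add_sq C).integrableOn.mono' ?_ ?_
    · obtain ⟨u, hu⟩ := (𝓝[<] Real.pi).exists_seq_tendsto
      obtain ⟨N, hN⟩ := eventually_atTop.1 (hu.eventually hmem)
      have hu' : Tendsto (fun n => u (n + N)) atTop (𝓝[<] Real.pi) :=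
        hu.comp (tendsto_add_atTop_nat N)
      exact aestronglyMeasurable_of_tendsto_ae atTop
        (fun n => hmeas _ (hN (n + N) (Nat.le_add_left _ _))) (hptw'.mono fun r hr => hr.comp hu')
    · filter_upwards [hptw', ae_restrict_mem measurableSet_Ioi] with r h1 h2
      exact le_of_tendsto h1.norm (hmem.mono fun θ hθ => hb θ hθ r h2)
  refine ⟨hint, ?_⟩
  have hlim : Tendsto (fun θ => rayIntegral (jumpKernel μσ με t) a θ) (𝓝[<] Real.pi)
      (𝓝 (∫ r in Ioi (0 : ℝ), jumpKernel μσ με t ((a - r : ℝ) : ℂ) * (-1))) := by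
    refine tendsto_integral_filter_of_dominated_convergence (fun r => C / (1 + r ^ 2)) ?_ ?_
      (integrable_const_div_one_add_sq C).integrableOn ?_
    · exact hmem.mono fun θ hθ => (hmeas θ hθ).mul_const _
    · filter_upwards [hmem] with θ hθ
      filter_upwards [ae_restrict_mem measurableSet_Ioi] with r hr
      rw [norm_mul, Complex.norm_exp_ofReal_mul_I, mul_one]
      exact hb θ hθ r hr
    · filter_upwards [hptw'] with r hr
      refine hr.mul ?_
      have h1 : Continuous (fun θ : ℝ => Complex.exp (θ * Complex.I)) := by fun_prop
      have := h1.continuousAt.tendsto (x := Real.pi)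
      rw [Complex.exp_pi_mul_I] at this
      exact this.mono_left nhdsWithin_le_nhds
  have huniq := tendsto_nhds_unique hlim
    (tendsto_const_nhds.congr' (hconst.mono fun θ hθ => hθ.symm))
  rw [← huniq, integral_mul_const]
  ring

lemma rayIntegral_neg {F : ℂ → ℂ} {a θ : ℝ}
    (hF : ∀ r > 0, F ((starRingEnd ℂ) (ray a θ r)) = (starRingEnd ℂ) (F (ray a θ r))) :
    rayIntegral F a (-θ) = (starRingEnd ℂ) (rayIntegral F a θ) := by
  rw [rayIntegral, rayIntegral, ← integral_conj]
  refine setIntegral_congr_fun measurableSet_Ioi fun r hr => ?_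
  rw [ray_neg, hF r hr, map_mul, ← Complex.exp_conj]
  simp

lemma phiRatio_im_neg_of_lt (h : Admissible μσ με) {a r : ℝ} (hr : a < r) :
    (phiRatio μσ με ((a - r : ℝ) : ℂ)).im < 0 := by
  refine phiRatio_im_neg h ?_ ?_
  · rw [Complex.ofReal_ne_zero]
    linarith
  · rw [Complex.arg_ofReal_of_neg (by linarith)]
    exact Real.pi_pos

lemma jumpDensity_pos (h : Admissible μσ με) {a t r : ℝ} (hr : a < r) :
    0 < jumpDensity μσ με a t r := by
  rw [jumpDensity_eq]
  exact mul_pos (mul_pos_of_neg_of_neg (by linarith) (phiRatio_im_neg_of_lt h hr)) (Real.exp_pos _)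

/-- The size of the jump of `∂K/∂x` at `(0, t)`. -/
noncomputable def jump (μσ με : Measure ℝ) (a t : ℝ) : ℝ :=
  1 / Real.pi * ∫ r in Ioi (0 : ℝ), jumpDensity μσ με a t r

lemma integrableOn_jumpDensity (h : Admissible μσ με) {a t : ℝ} (ha : 0 < a) (ht : 0 < t) :
    IntegrableOn (jumpDensity μσ με a t) (Ioi 0) :=
  (integrableOn_and_rayIntegral_jumpKernel h ha ht).1.im

lemma jump_pos (h : Admissible μσ με) {a t : ℝ} (ha : 0 < a) (ht : 0 < t) :
    0 < jump μσ με a t := by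
  refine mul_pos (by positivity) ?_
  have hne : ∀ᵐ r ∂(volume.restrict (Ioi (0 : ℝ))), r ≠ a :=
    ae_restrict_of_ae (Measure.ae_ne volume a)
  rw [integral_pos_iff_support_of_nonneg_ae ?_ (integrableOn_jumpDensity h ha ht)]
  · refine lt_of_lt_of_le (b := volume.restrict (Ioi (0 : ℝ)) (Ioi a)) ?_
      (measure_mono fun r hr => (jumpDensity_pos h hr).ne')
    rw [Measure.restrict_apply measurableSet_Ioi, Ioi_inter_Ioi]
    simp
  · filter_upwards [hne] with r hr
    rcases lt_or_gt_of_ne hr with h' | h'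
    · exact (jumpDensity_of_lt _ _ h').ge
    · exact (jumpDensity_pos h h').le

/-- The jump does not increase with time; in particular it does not fade out as `t → 0`. -/
lemma jump_antitone (h : Admissible μσ με) {a t₁ t₂ : ℝ} (ha : 0 < a) (ht₁ : 0 < t₁)
    (ht : t₁ ≤ t₂) : jump μσ με a t₂ ≤ jump μσ με a t₁ := by
  refine mul_le_mul_of_nonneg_left ?_ (by positivity)
  have hne : ∀ᵐ r ∂(volume.restrict (Ioi (0 : ℝ))), r ≠ a :=
    ae_restrict_of_ae (Measure.ae_ne volume a)
  refine integral_mono_ae (integrableOn_jumpDensity h ha (ht₁.trans_le ht))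
    (integrableOn_jumpDensity h ha ht₁) ?_
  filter_upwards [hne] with r hr
  rcases lt_or_gt_of_ne hr with h' | h'
  · rw [jumpDensity_of_lt _ _ h', jumpDensity_of_lt _ _ h']
  · rw [jumpDensity_eq, jumpDensity_eq]
    have := phiRatio_im_neg_of_lt h h'
    refine mul_le_mul_of_nonneg_left (Real.exp_le_exp.2 ?_)
      (mul_pos_of_neg_of_neg (by linarith) this).le
    nlinarith

lemma bromwich_jumpKernel (h : Admissible μσ με) {a t : ℝ} (ha : 0 < a) (ht : 0 < t) :
    bromwich (jumpKernel μσ με t) a (2 * Real.pi / 3) = -(jump μσ με a t : ℂ) := by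
  obtain ⟨hint, hJ⟩ := integrableOn_and_rayIntegral_jumpKernel h ha ht
  have hconj : rayIntegral (jumpKernel μσ με t) a (-(2 * Real.pi / 3)) =
      (starRingEnd ℂ) (rayIntegral (jumpKernel μσ με t) a (2 * Real.pi / 3)) := by
    refine rayIntegral_neg fun r hr => ?_
    have hs := ray_mem_slitPlane ha hr abs_two_pi_div_three.le
    rw [jumpKernel, jumpKernel, phiRatio_conj _ _ hs, map_mul, map_mul, ← Complex.exp_conj, map_mul,
      Complex.conj_ofReal]
  have him : (rayIntegral (jumpKernel μσ με t) a (2 * Real.pi / 3)).im =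
      -∫ r in Ioi (0 : ℝ), jumpDensity μσ με a t r := by
    rw [hJ, Complex.neg_im]
    congr 1
    exact (Complex.imCLM.integral_comp_comm hint).symm
  have hpi : (Real.pi : ℂ) ≠ 0 := by exact_mod_cast Real.pi_ne_zero
  -- the two rays are conjugate, so only the imaginary part on the cut survives
  rw [bromwich, hconj, Complex.sub_conj, him, jump]
  push_cast
  field_simp

end Jump

/-! ### The inverse Laplace transform in the cone -/

section TestTransform

/-- The two-sided Laplace transform `∫ ψ(t) e^{st} dt` of a compactly supported function. -/
noncomputable def testTransform (ψ : ℝ → ℂ) (s : ℂ) : ℂ := ∫ t : ℝ, ψ t * Complex.exp (s * t)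

lemma integrable_mul_of_hasCompactSupport {ψ g : ℝ → ℂ} (hψ : Continuous ψ)
    (hc : HasCompactSupport ψ) (hg : Continuous g) : Integrable (fun t => ψ t * g t) :=
  (hψ.mul hg).integrable_of_hasCompactSupport hc.mul_right

lemma testTransform_deriv {ψ : ℝ → ℂ} (hψ : ContDiff ℝ 1 ψ) (hc : HasCompactSupport ψ) (s : ℂ) :
    testTransform (deriv ψ) s = -(s * testTransform ψ s) := by
  have hexp : ∀ t : ℝ, HasDerivAt (fun t : ℝ => Complex.exp (s * t)) (s * Complex.exp (s * t)) t := by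
    intro t
    have h1 : HasDerivAt (fun t : ℝ => s * (t : ℂ)) (s * 1) t :=
      (Complex.ofRealCLM.hasDerivAt (x := t)).const_mul s
    have h2 := h1.cexp
    rwa [mul_one, mul_comm] at h2
  have hd : Continuous (deriv ψ) := hψ.continuous_deriv le_rfl
  have hcd : HasCompactSupport (deriv ψ) := hc.deriv
  have key := integral_mul_deriv_eq_deriv_mul_of_integrable (u := ψ) (u' := deriv ψ)
    (v := fun t : ℝ => Complex.exp (s * t)) (v' := fun t : ℝ => s * Complex.exp (s * t))
    (fun t _ => (hψ.differentiable one_ne_zero).differentiableAt.hasDerivAt) (fun t _ => hexp t)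
    (integrable_mul_of_hasCompactSupport hψ.continuous hc (by fun_prop))
    (integrable_mul_of_hasCompactSupport hd hcd (by fun_prop))
    (integrable_mul_of_hasCompactSupport hψ.continuous hc (by fun_prop))
  rw [testTransform, testTransform, eq_neg_iff_add_eq_zero, add_comm, ← eq_neg_iff_add_eq_zero,
    ← key, ← integral_const_mul]
  congr 1
  ext t
  ring

lemma differentiable_testTransform {ψ : ℝ → ℂ} (hψ : Continuous ψ) (hc : HasCompactSupport ψ) :
    Differentiable ℂ (testTransform ψ) := by
  intro s₀
  have hcn : HasCompactSupport (fun t => ‖ψ t‖) := hc.norm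
  refine (hasDerivAt_integral_of_dominated_loc_of_deriv_le (𝕜 := ℂ)
    (F' := fun s t => ψ t * (t * Complex.exp (s * t)))
    (bound := fun t => ‖ψ t‖ * (|t| * Real.exp ((‖s₀‖ + 1) * |t|)))
    (Metric.ball_mem_nhds s₀ one_pos) ?_ ?_ ?_ ?_ ?_ ?_).2.differentiableAt
  · exact Eventually.of_forall fun s => Continuous.aestronglyMeasurable (by fun_prop)
  · exact integrable_mul_of_hasCompactSupport hψ hc (by fun_prop)
  · exact Continuous.aestronglyMeasurable (by fun_prop)
  · refine ae_of_all _ fun t s hs => ?_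
    rw [norm_mul, norm_mul, Complex.norm_real, Real.norm_eq_abs, Complex.norm_exp]
    gcongr
    refine (le_abs_self _).trans ?_
    rw [Complex.re_mul_ofReal, abs_mul]
    refine mul_le_mul_of_nonneg_right ((Complex.abs_re_le_norm s).trans ?_) (abs_nonneg t)
    have := norm_sub_norm_le s s₀
    rw [Metric.mem_ball, dist_eq_norm] at hs
    linarith
  · exact ((hψ.norm.mul (by fun_prop)).integrable_of_hasCompactSupport hcn.mul_right)
  · refine ae_of_all _ fun t s _ => ?_
    have h1 : HasDerivAt (fun s : ℂ => s * (t : ℂ)) (1 * (t : ℂ)) s :=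
      (hasDerivAt_id s).mul_const _
    have h2 := (h1.cexp).const_mul (ψ t)
    rw [one_mul, mul_comm (Complex.exp _)] at h2
    exact h2

/-- The inverse Laplace integral over a vertical line is the Bromwich integral with opening angle
`π / 2`. -/
lemma integral_vertical_eq {F : ℂ → ℂ} {a : ℝ}
    (h1 : IntegrableOn (fun r => F (ray a (Real.pi / 2) r)) (Ioi 0))
    (h2 : IntegrableOn (fun r => F (ray a (-(Real.pi / 2)) r)) (Ioi 0)) :
    ∫ y : ℝ, F (a + y * Complex.I) = 2 * Real.pi * bromwich F a (Real.pi / 2) := by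
  have e1 : ∀ r : ℝ, ray a (Real.pi / 2) r = a + r * Complex.I := fun r => by
    rw [ray]; push_cast; rw [Complex.exp_pi_div_two_mul_I]
  have e2 : ∀ r : ℝ, ray a (-(Real.pi / 2)) r = a + (-r : ℝ) * Complex.I := fun r => by
    rw [ray_neg, e1]; simp
  simp only [e1] at h1
  simp only [e2] at h2
  have h2' : IntegrableOn (fun y : ℝ => F (a + y * Complex.I)) (Iic 0) := by
    have h2c := ((integrableOn_Ici_iff_integrableOn_Ioi).2 h2)
    rw [← neg_zero] at h2c
    simpa using h2c.comp_neg_Iic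
  rw [← intervalIntegral.integral_Iic_add_Ioi h2' h1]
  have h3 := integral_comp_neg_Ioi (0 : ℝ) (fun y : ℝ => F (a + y * Complex.I))
  rw [neg_zero] at h3
  rw [← h3, bromwich, rayIntegral, rayIntegral, integral_mul_const, integral_mul_const]
  simp only [e1, e2]
  have hI : Complex.exp ((Real.pi / 2 : ℝ) * Complex.I) = Complex.I := by
    push_cast; exact Complex.exp_pi_div_two_mul_I
  have hI' : Complex.exp ((-(Real.pi / 2) : ℝ) * Complex.I) = -Complex.I := by
    push_cast
    rw [neg_mul, Complex.exp_neg, Complex.exp_pi_div_two_mul_I, Complex.inv_I]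
  rw [hI, hI']
  have hpi : (Real.pi : ℂ) ≠ 0 := by exact_mod_cast Real.pi_ne_zero
  generalize (∫ r in Ioi (0 : ℝ), F (a + r * Complex.I)) = A
  generalize (∫ r in Ioi (0 : ℝ), F (a + (-r : ℝ) * Complex.I)) = B
  field_simp
  ring

end TestTransform

section Representation
variable {μσ με : Measure ℝ} [IsFiniteMeasure μσ] [IsFiniteMeasure με]

/-- In the cone the decay of `e^{st}` in the left half-plane wins over the growth of
`e^{-ξ s Ψ(s)}`. -/
lemma re_exponent_le (h : Admissible μσ με) {a P : ℝ} (ha : 0 < a) (hP : IsContourBound μσ με a P)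
    {s : ℂ} (hs : s ∈ outerSector a) (hsa : s.re ≤ a) {ξ t : ℝ} (hξ : 0 ≤ ξ)
    (ht : 4 * P * ξ < t) :
    (-(ξ : ℂ) * s * Psi μσ με s + s * t).re ≤ a * t := by
  have h1 := min_le_re_mul_Psi h (outerSector_subset_slitPlane ha hs)
  have h2 := hP.2.1 s hs
  have hPξ : 0 ≤ P * ξ := mul_nonneg hP.1 hξ
  have ht0 : 0 < t := by linarith
  have e : (-(ξ : ℂ) * s * Psi μσ με s + s * t).re = -ξ * (s * Psi μσ με s).re + s.re * t := by
    rw [Complex.add_re, Complex.re_mul_ofReal, mul_assoc, ← Complex.ofReal_neg,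
      Complex.re_ofReal_mul]
  rw [e]
  rcases le_total 0 s.re with h0 | h0
  · rw [min_eq_left (mul_nonneg (norm_nonneg _) h0)] at h1
    nlinarith [mul_nonneg hξ h1, mul_le_mul_of_nonneg_right hsa ht0.le]
  · rw [min_eq_right (mul_nonpos_of_nonneg_of_nonpos (norm_nonneg _) h0)] at h1
    have h3 : P * s.re ≤ (s * Psi μσ με s).re :=
      (mul_le_mul_of_nonpos_right h2 h0).trans h1
    have h4 : -ξ * (s * Psi μσ με s).re ≤ -ξ * (P * s.re) := by
      nlinarith [mul_le_mul_of_nonneg_left h3 hξ]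
    have h5 : (t - P * ξ) * s.re ≤ 0 :=
      mul_nonpos_of_nonneg_of_nonpos (by linarith) h0
    nlinarith [mul_pos ha ht0]

/-- The Laplace-side integrand `½ Ψ e^{-ξ s Ψ}` paired with the transform of a test function. -/
noncomputable def pairedKernel (μσ με : Measure ℝ) (ξ : ℝ) (ψ : ℝ → ℂ) (s : ℂ) : ℂ :=
  1 / 2 * Psi μσ με s * Complex.exp (-(ξ : ℂ) * s * Psi μσ με s) * testTransform ψ s

lemma differentiableAt_pairedKernel (h : Admissible μσ με) {ξ : ℝ} {ψ : ℝ → ℂ}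
    (hψ : Continuous ψ) (hc : HasCompactSupport ψ) {s : ℂ} (hs : s ∈ Complex.slitPlane) :
    DifferentiableAt ℂ (pairedKernel μσ με ξ ψ) s := by
  have h1 := differentiableAt_Psi h hs
  have h2 := differentiable_testTransform hψ hc s
  unfold pairedKernel
  fun_prop

/-- The integrand decays like `|s|⁻²` between the vertical line and the rays: by two integrations by
parts `s² ∫ ψ e^{st} dt = ∫ ψ'' e^{st} dt`. -/
lemma exists_norm_pairedKernel_ray_le (h : Admissible μσ με) {a P : ℝ} (ha : 0 < a)
    (hP : IsContourBound μσ με a P) {ξ : ℝ} (hξ : 0 ≤ ξ) {ψ : ℝ → ℂ} (hψ : ContDiff ℝ ∞ ψ)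
    (hc : HasCompactSupport ψ) (hsupp : ∀ t ∈ tsupport ψ, 4 * P * ξ < t) :
    ∃ C : ℝ, ∀ θ, Real.pi / 2 ≤ |θ| → |θ| ≤ 2 * Real.pi / 3 → ∀ r > 0,
      ‖pairedKernel μσ με ξ ψ (ray a θ r)‖ ≤ C / (1 + r ^ 2) := by
  have hψ1 : ContDiff ℝ ∞ (deriv ψ) := (contDiff_infty_iff_deriv.1 hψ).2
  have hψ2 : ContDiff ℝ ∞ (deriv (deriv ψ)) := (contDiff_infty_iff_deriv.1 hψ1).2
  set χ := deriv (deriv ψ) with hχ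
  have hcχ : HasCompactSupport χ := hc.deriv.deriv
  have hsuppχ : tsupport χ ⊆ tsupport ψ := tsupport_deriv_subset.trans tsupport_deriv_subset
  set N : ℝ := ∫ t, ‖χ t‖ * Real.exp (a * t) with hN
  have hNi : Integrable (fun t => ‖χ t‖ * Real.exp (a * t)) :=
    (hψ2.continuous.norm.mul (by fun_prop)).integrable_of_hasCompactSupport hcχ.norm.mul_right
  have hN0 : 0 ≤ N := integral_nonneg fun t => by positivity
  set m : ℝ := min (a ^ 2) 1 / 2 with hm
  have hm0 : 0 < m := by positivity
  refine ⟨1 / 2 * P * N / m, fun θ hθ1 hθ2 r hr => ?_⟩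
  set s := ray a θ r with hs
  have hso : s ∈ outerSector a := ray_mem_outerSector ha hr hθ2
  have hsa : s.re ≤ a := by
    have hcos : Real.cos θ ≤ 0 := by
      rw [← Real.cos_abs]
      exact Real.cos_nonpos_of_pi_div_two_le_of_le hθ1 (by linarith [Real.pi_pos])
    rw [hs, ray_re]
    nlinarith
  have htr : testTransform χ s = s ^ 2 * testTransform ψ s := by
    rw [hχ, testTransform_deriv (hψ1.of_le (by simp)) hc.deriv,
      testTransform_deriv (hψ.of_le (by simp)) hc]
    ring
  have hbound : ‖Complex.exp (-(ξ : ℂ) * s * Psi μσ με s) * testTransform χ s‖ ≤ N := by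
    rw [testTransform, ← integral_const_mul]
    refine norm_integral_le_of_norm_le hNi (ae_of_all _ fun t => ?_)
    by_cases ht : t ∈ tsupport χ
    · have e : Complex.exp (-(ξ : ℂ) * s * Psi μσ με s) * (χ t * Complex.exp (s * t)) =
          χ t * Complex.exp (-(ξ : ℂ) * s * Psi μσ με s + s * t) := by
        rw [Complex.exp_add]; ring
      rw [e, norm_mul, Complex.norm_exp]
      gcongr
      exact re_exponent_le h ha hP hso hsa hξ (hsupp t (hsuppχ ht))
    · rw [image_eq_zero_of_notMem_tsupport ht]
      simp
  have hsq : m * (1 + r ^ 2) ≤ ‖s‖ ^ 2 := by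
    refine le_trans ?_ (sq_add_sq_le_norm_ray_sq ha hr hθ2)
    have h1 : min (a ^ 2) 1 ≤ a ^ 2 := min_le_left _ _
    have h2 : min (a ^ 2) 1 ≤ 1 := min_le_right _ _
    rw [hm]
    nlinarith [sq_nonneg r]
  have hspos : 0 < ‖s‖ ^ 2 := lt_of_lt_of_le (by positivity) hsq
  have hmain : ‖pairedKernel μσ με ξ ψ s‖ * ‖s‖ ^ 2 ≤ 1 / 2 * P * N := by
    have e : pairedKernel μσ με ξ ψ s * s ^ 2 = 1 / 2 * Psi μσ με s *
        (Complex.exp (-(ξ : ℂ) * s * Psi μσ με s) * testTransform χ s) := by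
      rw [htr, pairedKernel]; ring
    rw [← norm_pow, ← norm_mul, e, norm_mul, norm_mul]
    have h2 : ‖(1 / 2 : ℂ)‖ = 1 / 2 := by norm_num
    rw [h2]
    have := hP.2.1 s hso
    have hP0 := hP.1
    gcongr
  rw [le_div_iff₀ (by positivity), le_div_iff₀ hm0]
  refine le_trans ?_ hmain
  rw [mul_assoc, mul_comm _ m]
  exact mul_le_mul_of_nonneg_left hsq (norm_nonneg _)

/-- Fubini's theorem on the two rays. -/
lemma rayIntegral_pairedKernel (h : Admissible μσ με) {a P : ℝ} (ha : 0 < a)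
    (hP : IsContourBound μσ με a P) {ξ : ℝ} (hξ : 0 ≤ ξ) {ψ : ℝ → ℂ} (hψ : Continuous ψ)
    (hc : HasCompactSupport ψ) (hsupp : ∀ t ∈ tsupport ψ, 4 * P * ξ < t) {θ : ℝ}
    (hθ : |θ| = 2 * Real.pi / 3) :
    Integrable (fun t => ψ t * rayIntegral (waveKernel μσ με ξ t) a θ) ∧
    rayIntegral (pairedKernel μσ με ξ ψ) a θ =
      ∫ t, ψ t * rayIntegral (waveKernel μσ με ξ t) a θ := by
  have d := rayData h ha hP hθ
  obtain ⟨t₀, ht₀, htsupp⟩ := hc.isCompact.exists_forall_le' (f := fun t : ℝ => t)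
    continuousOn_id (a := 0) fun t ht =>
      lt_of_le_of_lt (mul_nonneg (mul_nonneg (by norm_num) hP.1) hξ) (hsupp t ht)
  set f : ℝ → ℝ → ℂ := fun r t =>
    ψ t * (waveKernel μσ με ξ t (ray a θ r) * Complex.exp (θ * Complex.I)) with hf
  have hfeq : ∀ r t, f r t = ψ t * (1 / 2 * Psi μσ με (ray a θ r) * Complex.exp (θ * Complex.I) *
        Complex.exp (linForm (-(ray a θ r * Psi μσ με (ray a θ r))) (ray a θ r) (ξ, t))) :=
    fun r t => by rw [hf, ← waveKernel_ray_mul]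
  have hint : Integrable (Function.uncurry f) ((volume.restrict (Ioi (0 : ℝ))).prod volume) := by
    have hg1 : Integrable (fun r : ℝ => P * Real.exp (-(t₀ / 4) * r))
        (volume.restrict (Ioi (0 : ℝ))) :=
      (exp_neg_integrableOn_Ioi 0 (by positivity)).const_mul P
    have hg2 : Integrable (fun t : ℝ => ‖ψ t‖ * Real.exp (t * (a + 1 / 4))) :=
      (hψ.norm.mul (by fun_prop)).integrable_of_hasCompactSupport hc.norm.mul_right
    refine (hg1.mul_prod hg2).mono' ?_ ?_
    · have hprod : (volume.restrict (Ioi (0 : ℝ))).prod (volume : Measure ℝ) =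
          (volume.prod volume).restrict (Ioi (0 : ℝ) ×ˢ univ) := by
        rw [← Measure.prod_restrict, Measure.restrict_univ]
      rw [hprod]
      refine ContinuousOn.aestronglyMeasurable ?_ (measurableSet_Ioi.prod MeasurableSet.univ)
      have m : MapsTo (Prod.fst : ℝ × ℝ → ℝ) (Ioi (0 : ℝ) ×ˢ univ) (Ioi 0) := fun p hp => hp.1
      have k1 := d.cont_c.comp continuousOn_fst m
      have k2 := d.cont_p.comp continuousOn_fst m
      have k3 := d.cont_q.comp continuousOn_fst m
      have e : Function.uncurry f = fun p : ℝ × ℝ => ψ p.2 *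
          (1 / 2 * Psi μσ με (ray a θ p.1) * Complex.exp (θ * Complex.I) *
          Complex.exp (ξ * (-(ray a θ p.1 * Psi μσ με (ray a θ p.1))) + p.2 * ray a θ p.1)) := by
        funext p
        rw [Function.uncurry, hfeq, linForm_apply]
      rw [e]
      refine (hψ.comp_continuousOn continuousOn_snd).mul (k1.mul ?_)
      refine ContinuousOn.cexp ((continuousOn_const.mul k2).add (ContinuousOn.mul ?_ k3))
      exact (Complex.continuous_ofReal.comp continuous_snd).continuousOn
    · have hae : ∀ᵐ p ∂((volume.restrict (Ioi (0 : ℝ))).prod (volume : Measure ℝ)),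
          p.1 ∈ Ioi (0 : ℝ) :=
        Measure.quasiMeasurePreserving_fst.ae (ae_restrict_mem measurableSet_Ioi)
      filter_upwards [hae] with p hp
      rw [Function.uncurry, hfeq, norm_mul, norm_mul]
      by_cases ht : p.2 ∈ tsupport ψ
      · have hz : (ξ, p.2) ∈ cone P := by
          change 4 * P * |ξ| < p.2
          rw [abs_of_nonneg hξ]
          exact hsupp _ ht
        have b1 := d.norm_c p.1 hp
        have b2 := d.norm_exp_le hz hp
        have b3 : Real.exp (-(p.2 / 4) * p.1) ≤ Real.exp (-(t₀ / 4) * p.1) := by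
          refine Real.exp_le_exp.2 (mul_le_mul_of_nonneg_right ?_ (le_of_lt hp))
          linarith [htsupp _ ht]
        have hP0 := hP.1
        simp only at b2
        calc _ ≤ ‖ψ p.2‖ * (P * (Real.exp (p.2 * (a + 1 / 4)) * Real.exp (-(t₀ / 4) * p.1))) := by
              gcongr
              exact b2.trans (by gcongr)
          _ = _ := by ring
      · rw [image_eq_zero_of_notMem_tsupport ht]
        simp
  have hinner : ∀ t, ∫ r in Ioi (0 : ℝ), f r t =
      ψ t * rayIntegral (waveKernel μσ με ξ t) a θ := fun t => by
    rw [hf, rayIntegral]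
    exact integral_const_mul _ _
  constructor
  · have := hint.integral_prod_right
    simpa only [Function.uncurry, hinner] using this
  · simp only [← hinner]
    rw [← integral_integral_swap hint, rayIntegral]
    congr 1
    ext r
    rw [pairedKernel, testTransform, ← integral_const_mul, ← integral_mul_const]
    congr 1
    ext t
    simp only [hf]
    rw [waveKernel, Complex.exp_add]
    ring

/-- The inverse Laplace transform in `t`, for fixed `x`: the vertical line is turned into the two
rays, along which the integrals over `s` and `t` can be exchanged. -/
lemma integral_STilde (h : Admissible μσ με) {a P : ℝ} (ha : 0 < a)
    (hP : IsContourBound μσ με a P) (x : ℝ) {ψ : ℝ → ℂ} (hψ : ContDiff ℝ ∞ ψ)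
    (hc : HasCompactSupport ψ) (hsupp : ∀ t ∈ tsupport ψ, 4 * P * |x| < t) :
    ∫ y : ℝ, STilde μσ με x ((a : ℂ) + (y : ℂ) * Complex.I) *
      ((1 / (2 * (Real.pi : ℂ))) *
        ∫ t : ℝ, deriv ψ t * Complex.exp (((a : ℂ) + (y : ℂ) * Complex.I) * (t : ℂ))) =
    -∫ t : ℝ, waveProfile μσ με a (|x|, t) * ψ t := by
  have hpi := Real.pi_pos
  have hpiC : (Real.pi : ℂ) ≠ 0 := by exact_mod_cast Real.pi_ne_zero
  obtain ⟨C, hb⟩ := exists_norm_pairedKernel_ray_le h ha hP (abs_nonneg x) hψ hc hsupp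
  have hdiff : ∀ r > 0, ∀ θ, |θ| ≤ 2 * Real.pi / 3 →
      DifferentiableAt ℂ (pairedKernel μσ με |x| ψ) (ray a θ r) := fun r hr θ hθ =>
    differentiableAt_pairedKernel h hψ.continuous hc (ray_mem_slitPlane ha hr hθ)
  have hintg : ∀ r : ℝ, STilde μσ με x ((a : ℂ) + (r : ℂ) * Complex.I) *
      ((1 / (2 * (Real.pi : ℂ))) *
        ∫ t : ℝ, deriv ψ t * Complex.exp (((a : ℂ) + (r : ℂ) * Complex.I) * (t : ℂ))) =
      -(1 / (2 * (Real.pi : ℂ))) *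
        pairedKernel μσ με |x| ψ ((a : ℂ) + (r : ℂ) * Complex.I) := fun r => by
    have hs0 : (a : ℂ) + (r : ℂ) * Complex.I ≠ 0 := fun h0 => by
      have := congrArg Complex.re h0
      simp at this
      exact ha.ne' this
    have := testTransform_deriv (hψ.of_le (by simp)) hc ((a : ℂ) + (r : ℂ) * Complex.I)
    rw [testTransform] at this
    rw [this, STilde, pairedKernel]
    field_simp
  simp only [hintg]
  have hI : ∀ θ, |θ| = Real.pi / 2 →
      IntegrableOn (fun r => pairedKernel μσ με |x| ψ (ray a θ r)) (Ioi 0) := by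
    intro θ hθ
    have hθ2 : |θ| ≤ 2 * Real.pi / 3 := by rw [hθ]; linarith
    refine integrableOn_Ioi_of_norm_le (fun r hr => ?_) (fun r hr => hb θ hθ.ge hθ2 r hr)
    exact ((hdiff r hr θ hθ2).continuousAt.comp
      (continuous_ray a θ).continuousAt).continuousWithinAt
  have hpi2 : |Real.pi / 2| = Real.pi / 2 := abs_of_pos (by positivity)
  rw [integral_const_mul, integral_vertical_eq (hI _ hpi2) (hI _ (by rw [abs_neg, hpi2])),
    bromwich]
  have r1 : rayIntegral (pairedKernel μσ με |x| ψ) a (Real.pi / 2) =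
      rayIntegral (pairedKernel μσ με |x| ψ) a (2 * Real.pi / 3) := by
    have key : ∀ θ ∈ Icc (Real.pi / 2) (2 * Real.pi / 3), |θ| = θ := fun θ hθ =>
      abs_of_nonneg (by linarith [hθ.1])
    refine rayIntegral_eq (C := C) (by linarith) (fun r hr θ hθ => ?_) (fun r hr θ hθ => ?_)
    · exact hdiff r hr θ (by rw [key θ hθ]; exact hθ.2)
    · exact hb θ (by rw [key θ hθ]; exact hθ.1) (by rw [key θ hθ]; exact hθ.2) r hr
  have r2 : rayIntegral (pairedKernel μσ με |x| ψ) a (-(Real.pi / 2)) =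
      rayIntegral (pairedKernel μσ με |x| ψ) a (-(2 * Real.pi / 3)) := by
    have key : ∀ θ ∈ Icc (-(2 * Real.pi / 3)) (-(Real.pi / 2)), |θ| = -θ := fun θ hθ =>
      abs_of_nonpos (by linarith [hθ.2])
    refine (rayIntegral_eq (C := C) (by linarith) (fun r hr θ hθ => ?_)
      (fun r hr θ hθ => ?_)).symm
    · exact hdiff r hr θ (by rw [key θ hθ]; linarith [hθ.1])
    · exact hb θ (by rw [key θ hθ]; linarith [hθ.2]) (by rw [key θ hθ]; linarith [hθ.1]) r hr
  obtain ⟨i1, f1⟩ := rayIntegral_pairedKernel h ha hP (abs_nonneg x) hψ.continuous hc hsupp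
    (θ := 2 * Real.pi / 3) abs_two_pi_div_three
  obtain ⟨i2, f2⟩ := rayIntegral_pairedKernel h ha hP (abs_nonneg x) hψ.continuous hc hsupp
    (θ := -(2 * Real.pi / 3)) (by rw [abs_neg]; exact abs_two_pi_div_three)
  rw [r1, r2, f1, f2, ← integral_sub i1 i2]
  have e : ∀ t, waveProfile μσ με a (|x|, t) * ψ t = 1 / (2 * Real.pi * Complex.I) *
      (ψ t * rayIntegral (waveKernel μσ με |x| t) a (2 * Real.pi / 3) -
        ψ t * rayIntegral (waveKernel μσ με |x| t) a (-(2 * Real.pi / 3))) := fun t => by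
    rw [waveProfile, bromwich]
    ring
  simp only [e]
  rw [integral_const_mul]
  field_simp

/-- `K` as a function near the half-line `x = 0`, `t > 0`. -/
noncomputable def waveFun (μσ με : Measure ℝ) (a : ℝ) (p : ℝ × ℝ) : ℂ :=
  waveProfile μσ με a (|p.1|, p.2)

lemma abs_fst_mem_cone {P : ℝ} {p : ℝ × ℝ} (hp : p ∈ cone P) : (|p.1|, p.2) ∈ cone P := by
  change 4 * P * |(|p.1|)| < p.2
  rw [abs_abs]
  exact hp

lemma continuousOn_waveFun (h : Admissible μσ με) {a P : ℝ} (ha : 0 < a)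
    (hP : IsContourBound μσ με a P) : ContinuousOn (waveFun μσ με a) (cone P) :=
  (waveProfile_regular h ha hP).1.continuousOn.comp
    (f := fun p : ℝ × ℝ => ((|p.1|, p.2) : ℝ × ℝ)) (by fun_prop) fun _ hp => abs_fst_mem_cone hp

lemma representedOn_K (h : Admissible μσ με) {a P : ℝ} (ha : 0 < a)
    (hP : IsContourBound μσ με a P) :
    RepresentedOn (K μσ με a) (cone P) (waveFun μσ με a) := by
  have hcont := continuousOn_waveFun h ha hP
  refine ⟨hcont.locallyIntegrableOn (isOpen_cone P).measurableSet, fun φ hφ hc hsupp => ?_⟩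
  have hint : Integrable (fun p => waveFun μσ με a p * φ p) := by
    refine Continuous.integrable_of_hasCompactSupport ?_ hc.mul_left
    refine (hcont.mul hφ.continuous.continuousOn).continuous_of_tsupport_subset (isOpen_cone P) ?_
    exact (tsupport_mul_subset_right).trans hsupp
  rw [Measure.volume_eq_prod, integral_prod _ (by rwa [← Measure.volume_eq_prod])]
  rw [K, distPartialT, S, invLaplace, ← integral_neg]
  congr 1
  ext x
  have hslice : ContDiff ℝ ∞ (fun t : ℝ => φ (x, t)) := hφ.comp (contDiff_prodMk_right x)
  have hemb : IsClosedEmbedding (fun t : ℝ => (x, t)) := by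
    refine Topology.IsClosedEmbedding.of_continuous_injective_isClosedMap (by fun_prop)
      (fun t u htu => (Prod.ext_iff.1 htu).2) ?_
    exact fun s hs => by
      have : (fun t : ℝ => (x, t)) '' s = {x} ×ˢ s := by
        ext p
        constructor
        · rintro ⟨t, ht, rfl⟩
          exact ⟨rfl, ht⟩
        · rintro ⟨h1, h2⟩
          exact ⟨p.2, h2, Prod.ext h1.symm rfl⟩
      rw [this]
      exact isClosed_singleton.prod hs
  have hcs : HasCompactSupport (fun t : ℝ => φ (x, t)) := hc.comp_isClosedEmbedding hemb
  have hss : ∀ t ∈ tsupport (fun t : ℝ => φ (x, t)), 4 * P * |x| < t := fun t ht =>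
    hsupp (tsupport_comp_subset_preimage φ (f := fun t : ℝ => (x, t)) (by fun_prop) ht)
  have hd : ∀ t : ℝ, partialT φ (x, t) = deriv (fun t : ℝ => φ (x, t)) t := fun t => by
    have h1 : HasDerivAt (fun t : ℝ => (x, t)) ((0 : ℝ), (1 : ℝ)) t :=
      (hasDerivAt_const t x).prodMk (hasDerivAt_id t)
    have h2 := ((hφ.differentiable (by simp)) (x, t)).hasFDerivAt.comp_hasDerivAt t h1
    exact h2.deriv.symm
  simp only [hd]
  rw [integral_STilde h ha hP x hslice hcs hss, neg_neg]
  rfl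

end Representation

/-! ### Uniqueness of representatives and the discontinuity -/

section Distributions
variable {T : (ℝ × ℝ → ℂ) → ℂ} {U V : Set (ℝ × ℝ)} {f g : ℝ × ℝ → ℂ}

lemma integrable_mul_of_locallyIntegrableOn (hg : LocallyIntegrableOn g U) {φ : ℝ × ℝ → ℂ}
    (hφ : Continuous φ) (hc : HasCompactSupport φ) (hs : tsupport φ ⊆ U) :
    Integrable (fun p => g p * φ p) := by
  have hK := hg.integrableOn_compact_subset hs hc.isCompact
  obtain ⟨C, hC⟩ := hc.exists_bound_of_continuous hφ
  have h2 : IntegrableOn (fun p => g p * φ p) (tsupport φ) :=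
    hK.mul_bdd hφ.aestronglyMeasurable (ae_of_all _ hC)
  refine (integrableOn_iff_integrable_of_support_subset fun p hp => ?_).1 h2
  exact subset_tsupport φ (right_ne_zero_of_mul hp)

lemma RepresentedOn.ae_eq (hf : RepresentedOn T U f) (hg : RepresentedOn T V g) (hU : IsOpen U)
    (hV : IsOpen V) : ∀ᵐ p : ℝ × ℝ, p ∈ U ∩ V → f p = g p := by
  have hfl : LocallyIntegrableOn f (U ∩ V) := hf.1.mono_set inter_subset_left
  have hgl : LocallyIntegrableOn g (U ∩ V) := hg.1.mono_set inter_subset_right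
  have key := (hU.inter hV).ae_eq_zero_of_integral_contDiff_smul_eq_zero (hfl.sub hgl)
    fun η hη hc hs => ?_
  · filter_upwards [key] with p hp hpU
    exact sub_eq_zero.1 (hp hpU)
  have hφ : ContDiff ℝ ∞ (fun p => (η p : ℂ)) := Complex.ofRealCLM.contDiff.comp hη
  have hφc : HasCompactSupport (fun p => (η p : ℂ)) := hc.comp_left Complex.ofReal_zero
  have hφs : tsupport (fun p => (η p : ℂ)) ⊆ U ∩ V :=
    (closure_mono (Function.support_comp_subset Complex.ofReal_zero η)).trans hs
  have e1 := hf.2 _ hφ hφc (hφs.trans inter_subset_left)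
  have e2 := hg.2 _ hφ hφc (hφs.trans inter_subset_right)
  have e : ∀ p, η p • (f - g) p = f p * η p - g p * η p := fun p => by
    rw [Complex.real_smul, Pi.sub_apply]; ring
  simp only [e]
  rw [integral_sub (integrable_mul_of_locallyIntegrableOn hfl hφ.continuous hφc hφs)
    (integrable_mul_of_locallyIntegrableOn hgl hφ.continuous hφc hφs), ← e1, ← e2, sub_self]

lemma RepresentedOn.mono (hf : RepresentedOn T U f) (hVU : V ⊆ U) : RepresentedOn T V f :=
  ⟨hf.1.mono_set hVU, fun φ h1 h2 h3 => hf.2 φ h1 h2 (h3.trans hVU)⟩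

lemma continuousOn_partialX (hU : IsOpen U) (hf : ContDiffOn ℝ 1 f U) :
    ContinuousOn (partialX f) U :=
  (hf.continuousOn_fderiv_of_isOpen hU le_rfl).clm_apply continuousOn_const

/-- For a continuously differentiable function the distributional derivative is the pointwise
one. -/
lemma RepresentedOn.distPartialX (hf : RepresentedOn T U f) (hU : IsOpen U)
    (hf1 : ContDiffOn ℝ 1 f U) : RepresentedOn (distPartialX T) U (partialX f) := by
  have hl : LocallyIntegrableOn (partialX f) U :=
    (continuousOn_partialX hU hf1).locallyIntegrableOn hU.measurableSet
  refine ⟨hl, fun φ hφ hc hs => ?_⟩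
  have hdφ : ContDiff ℝ ∞ (partialX φ) :=
    (hφ.fderiv_right (m := ∞) (by simp)).clm_apply contDiff_const
  have hds : tsupport (partialX φ) ⊆ tsupport φ := tsupport_fderiv_apply_subset ℝ (1, 0)
  have hdc : HasCompactSupport (partialX φ) := hc.of_isClosed_subset (isClosed_tsupport _) hds
  rw [FractionalWave.distPartialX, hf.2 _ hdφ hdc (hds.trans hs), neg_eq_iff_eq_neg]
  exact integral_mul_fderiv_eq_neg_fderiv_mul_of_integrable
    (integrable_mul_of_locallyIntegrableOn hl hφ.continuous hc hs)
    (integrable_mul_of_locallyIntegrableOn hf.1 hdφ.continuous hdc (hds.trans hs))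
    (integrable_mul_of_locallyIntegrableOn hf.1 hφ.continuous hc hs)
    (fun p hp => (hf1.differentiableOn one_ne_zero).differentiableAt (hU.mem_nhds (hs hp)))
    (fun p _ => (hφ.differentiable (by simp)) p)

lemma norm_sub_le_of_ae {L : ℂ} {ε : ℝ} (hU : IsOpen U) (hf : ContinuousOn f U)
    (hae : ∀ᵐ p : ℝ × ℝ, p ∈ U → ‖f p - L‖ ≤ ε) : ∀ p ∈ U, ‖f p - L‖ ≤ ε := by
  have hopen : IsOpen (U ∩ {p | ε < ‖f p - L‖}) := by
    have hc : ContinuousOn (fun p => ‖f p - L‖) U := (hf.sub continuousOn_const).norm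
    exact hc.isOpen_inter_preimage hU isOpen_Ioi
  have hnull : volume (U ∩ {p | ε < ‖f p - L‖}) = 0 := by
    refine measure_mono_null (fun p hp => ?_) hae
    intro hc
    exact absurd (hc hp.1) (not_le.2 hp.2)
  have hempty := hopen.eq_empty_of_measure_zero hnull
  intro p hp
  by_contra! hc
  exact (hempty.le ⟨hp, hc⟩).elim

end Distributions

section Conclusion

lemma partialX_waveFun_of_pos (μσ με : Measure ℝ) (a : ℝ) {p : ℝ × ℝ}
    (hp : 0 < p.1) :
    partialX (waveFun μσ με a) p = partialX (waveProfile μσ με a) p := by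
  have he : waveFun μσ με a =ᶠ[𝓝 p] waveProfile μσ με a := by
    filter_upwards [(isOpen_lt continuous_const continuous_fst).mem_nhds hp] with q hq
    rw [waveFun, abs_of_pos hq]
  rw [partialX, partialX, he.fderiv_eq]

variable {μσ με : Measure ℝ} [IsFiniteMeasure μσ] [IsFiniteMeasure με]

lemma contDiffOn_waveFun (h : Admissible μσ με) {a P : ℝ} (ha : 0 < a)
    (hP : IsContourBound μσ με a P) :
    ContDiffOn ℝ 1 (waveFun μσ με a) (cone P ∩ {p | p.1 ≠ 0}) := by
  refine (waveProfile_regular h ha hP).1.comp (g := waveProfile μσ με a)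
    (f := fun p : ℝ × ℝ => ((|p.1|, p.2) : ℝ × ℝ)) ?_ fun p hp => abs_fst_mem_cone hp.1
  intro p hp
  have h1 : ContDiffAt ℝ 1 (fun p : ℝ × ℝ => |p.1|) p :=
    (contDiffAt_abs (n := 1) hp.2).comp p contDiffAt_fst
  exact (h1.prodMk contDiffAt_snd).contDiffWithinAt

lemma partialX_waveFun_of_neg (h : Admissible μσ με) {a P : ℝ} (ha : 0 < a)
    (hP : IsContourBound μσ με a P) {p : ℝ × ℝ} (hp : p.1 < 0) (hpc : p ∈ cone P) :
    partialX (waveFun μσ με a) p = -partialX (waveProfile μσ με a) (-p.1, p.2) := by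
  have he : waveFun μσ με a =ᶠ[𝓝 p] fun q => waveProfile μσ με a (-q.1, q.2) := by
    filter_upwards [(isOpen_lt continuous_fst continuous_const).mem_nhds hp] with q hq
    rw [waveFun, abs_of_neg hq]
  have hmem : (-p.1, p.2) ∈ cone P := by
    have := abs_fst_mem_cone hpc
    rwa [abs_of_neg hp] at this
  have hd : HasFDerivAt (waveProfile μσ με a) (fderiv ℝ (waveProfile μσ με a) (-p.1, p.2))
      (-p.1, p.2) :=
    (((waveProfile_regular h ha hP).1.differentiableOn one_ne_zero).differentiableAt
      ((isOpen_cone P).mem_nhds hmem)).hasFDerivAt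
  have hr : HasFDerivAt (fun q : ℝ × ℝ => ((-q.1, q.2) : ℝ × ℝ))
      ((-ContinuousLinearMap.fst ℝ ℝ ℝ).prod (ContinuousLinearMap.snd ℝ ℝ ℝ)) p :=
    (hasFDerivAt_fst.neg).prodMk hasFDerivAt_snd
  have hcomp := hd.comp p hr
  change HasFDerivAt (fun q : ℝ × ℝ => waveProfile μσ με a (-q.1, q.2)) _ p at hcomp
  rw [partialX, he.fderiv_eq, hcomp.fderiv, partialX, ← map_neg]
  simp

/-- The one-sided limits of `∂K/∂x` at `(0, t)` are `± jump / 2`. -/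
lemma tendsto_partialX_waveFun (h : Admissible μσ με) {a P : ℝ} (ha : 0 < a)
    (hP : IsContourBound μσ με a P) {t : ℝ} (ht : 0 < t) :
    Tendsto (partialX (waveFun μσ με a)) (𝓝[{p | 0 < p.1}] ((0 : ℝ), t))
      (𝓝 ((jump μσ με a t : ℂ) / 2)) ∧
    Tendsto (partialX (waveFun μσ με a)) (𝓝[{p | p.1 < 0}] ((0 : ℝ), t))
      (𝓝 (-((jump μσ με a t : ℂ) / 2))) := by
  obtain ⟨hreg, hval⟩ := waveProfile_regular h ha hP
  have hz : ((0 : ℝ), t) ∈ cone P := by simpa [cone] using ht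
  have hL : partialX (waveProfile μσ με a) (0, t) = (jump μσ με a t : ℂ) / 2 := by
    have := bromwich_jumpKernel h ha ht
    unfold jumpKernel at this
    rw [partialX, hval t ht, this]
    ring
  have hc : Tendsto (partialX (waveProfile μσ με a)) (𝓝 ((0 : ℝ), t))
      (𝓝 ((jump μσ με a t : ℂ) / 2)) := by
    rw [← hL]
    exact (continuousOn_partialX (isOpen_cone P) hreg).continuousAt ((isOpen_cone P).mem_nhds hz)
  constructor
  · refine (hc.mono_left nhdsWithin_le_nhds).congr' ?_
    filter_upwards [self_mem_nhdsWithin] with p hp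
    exact (partialX_waveFun_of_pos _ _ _ hp).symm
  · have hr : Tendsto (fun p : ℝ × ℝ => ((-p.1, p.2) : ℝ × ℝ)) (𝓝 ((0 : ℝ), t))
        (𝓝 ((0 : ℝ), t)) := by
      have h1 : Continuous (fun p : ℝ × ℝ => ((-p.1, p.2) : ℝ × ℝ)) := by fun_prop
      have := h1.tendsto ((0 : ℝ), t)
      simpa using this
    refine ((hc.comp hr).neg.mono_left nhdsWithin_le_nhds).congr' ?_
    filter_upwards [self_mem_nhdsWithin,
      mem_nhdsWithin_of_mem_nhds ((isOpen_cone P).mem_nhds hz)] with p hp hpc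
    exact (partialX_waveFun_of_neg h ha hP hp hpc).symm

/-- If `∂K/∂x` were continuous at `(0, t₀)`, the one-sided limits at `(0, t)` would approach each
other as `t` decreases to `t₀`; but the jump is at least the one at time `t₀ + 1`. -/
lemma not_continuousAt_distPartialX_K (h : Admissible μσ με) {a : ℝ} (ha : 0 < a) {t₀ : ℝ}
    (ht₀ : 0 ≤ t₀) : ¬ ∃ (U : Set (ℝ × ℝ)) (g : ℝ × ℝ → ℂ), IsOpen U ∧ ((0 : ℝ), t₀) ∈ U ∧
      RepresentedOn (distPartialX (K μσ με a)) U g ∧ ContinuousAt g ((0 : ℝ), t₀) := by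
  rintro ⟨U, g, hU, hmem, hrep, hcont⟩
  obtain ⟨P, hP⟩ := exists_isContourBound h ha
  set L := g (0, t₀) with hL
  set J := jump μσ με a (t₀ + 1) with hJ
  have hJ0 : 0 < J := jump_pos h ha (by linarith)
  set X : Set (ℝ × ℝ) := {p | p.1 ≠ 0} with hX
  have hXo : IsOpen X := isOpen_ne_fun continuous_fst continuous_const
  have hΩo : IsOpen (cone P ∩ X) := (isOpen_cone P).inter hXo
  have hC1 := contDiffOn_waveFun h ha hP
  have hcX := continuousOn_partialX hΩo hC1
  have hrep' := ((representedOn_K h ha hP).mono inter_subset_left).distPartialX hΩo hC1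
  have hae := hrep.ae_eq hrep' hU hΩo
  -- a neighbourhood of `(0, t₀)` where `g` is within `J / 4` of its value at the centre
  have hev : ∀ᶠ p in 𝓝 ((0 : ℝ), t₀), ‖g p - L‖ < J / 4 ∧ p ∈ U := by
    have := Metric.tendsto_nhds.1 hcont (J / 4) (by linarith)
    simp only [dist_eq_norm] at this
    exact this.and (hU.mem_nhds hmem)
  obtain ⟨N, hN, hNo, hN0⟩ := eventually_nhds_iff.1 hev
  -- a later time for which `(0, t)` still lies in it
  obtain ⟨t, ⟨htN, ht1⟩, ht0⟩ : ∃ t, (((0 : ℝ), t) ∈ N ∧ t < t₀ + 1) ∧ t₀ < t := by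
    have h1 : ∀ᶠ t in 𝓝 t₀, ((0 : ℝ), t) ∈ N :=
      (by fun_prop : Continuous fun t : ℝ => ((0 : ℝ), t)).continuousAt.eventually
        (hNo.mem_nhds hN0)
    have h2 : ∀ᶠ t in 𝓝 t₀, t < t₀ + 1 := Iio_mem_nhds (by linarith)
    exact (((h1.and h2).filter_mono (nhdsWithin_le_nhds (s := Ioi t₀))).and
      self_mem_nhdsWithin).exists
  have htp : 0 < t := lt_of_le_of_lt ht₀ ht0
  have hclose : ∀ p ∈ N ∩ (cone P ∩ X), ‖partialX (waveFun μσ με a) p - L‖ ≤ J / 4 := by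
    refine norm_sub_le_of_ae (hNo.inter hΩo) (hcX.mono inter_subset_right) ?_
    filter_upwards [hae] with p hp hpN
    rw [← hp ⟨(hN p hpN.1).2, hpN.2⟩]
    exact (hN p hpN.1).1.le
  obtain ⟨l1, l2⟩ := tendsto_partialX_waveFun h ha hP htp
  have hz : ((0 : ℝ), t) ∈ N ∩ cone P := ⟨htN, by simpa [cone] using htp⟩
  have hnear : N ∩ cone P ∈ 𝓝 ((0 : ℝ), t) := (hNo.inter (isOpen_cone P)).mem_nhds hz
  have hb1 : (𝓝[{p : ℝ × ℝ | 0 < p.1}] ((0 : ℝ), t)).NeBot := by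
    rw [← mem_closure_iff_nhdsWithin_neBot]
    have : {p : ℝ × ℝ | 0 < p.1} = Ioi 0 ×ˢ univ := by ext; simp
    rw [this, closure_prod_eq]
    simp
  have hb2 : (𝓝[{p : ℝ × ℝ | p.1 < 0}] ((0 : ℝ), t)).NeBot := by
    rw [← mem_closure_iff_nhdsWithin_neBot]
    have : {p : ℝ × ℝ | p.1 < 0} = Iio 0 ×ˢ univ := by ext; simp
    rw [this, closure_prod_eq]
    simp
  have b1 : ‖(jump μσ με a t : ℂ) / 2 - L‖ ≤ J / 4 := by
    refine le_of_tendsto (l1.sub_const L).norm ?_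
    filter_upwards [self_mem_nhdsWithin, mem_nhdsWithin_of_mem_nhds hnear] with p hp hpN
    exact hclose p ⟨hpN.1, hpN.2, ne_of_gt hp⟩
  have b2 : ‖-((jump μσ με a t : ℂ) / 2) - L‖ ≤ J / 4 := by
    refine le_of_tendsto (l2.sub_const L).norm ?_
    filter_upwards [self_mem_nhdsWithin, mem_nhdsWithin_of_mem_nhds hnear] with p hp hpN
    exact hclose p ⟨hpN.1, hpN.2, ne_of_lt hp⟩
  have hJt : J ≤ jump μσ με a t := jump_antitone h ha htp ht1.le
  have hnorm : ‖((jump μσ με a t : ℂ) / 2 - L) - (-((jump μσ με a t : ℂ) / 2) - L)‖ =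
      jump μσ με a t := by
    have e : ((jump μσ με a t : ℂ) / 2 - L) - (-((jump μσ με a t : ℂ) / 2) - L) =
        (jump μσ με a t : ℂ) := by ring
    rw [e, Complex.norm_real, Real.norm_of_nonneg (hJ0.le.trans hJt)]
  have := norm_sub_le ((jump μσ με a t : ℂ) / 2 - L) (-((jump μσ με a t : ℂ) / 2) - L)
  linarith

end Conclusion

end FractionalWave

theorem mainTheorem7 (μσ με : Measure ℝ) [IsFiniteMeasure μσ] [IsFiniteMeasure με]
    (hσ_supp : μσ (Icc (0 : ℝ) 1)ᶜ = 0) (hε_supp : με (Icc (0 : ℝ) 1)ᶜ = 0)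
    (hσ_ne : μσ ≠ 0) (hε_ne : με ≠ 0)
    (hT : FractionalWave.ThermoRestriction μσ με)
    (hproper : FractionalWave.IsProperFractional μσ με)
    (hprop : ¬ ∃ c : ℝ≥0, μσ = c • με)
    (a : ℝ) (ha : 0 < a) :
    -- near the open half-line `K` is a continuous function, `C¹` off `x = 0`, whose
    -- `x`-derivative has a jump at every point `(0, t)`, `t > 0`
    (∃ (Ω : Set (ℝ × ℝ)) (k : ℝ × ℝ → ℂ), IsOpen Ω ∧ (∀ t : ℝ, 0 < t → ((0 : ℝ), t) ∈ Ω) ∧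
      FractionalWave.RepresentedOn (FractionalWave.K μσ με a) Ω k ∧
      ContinuousOn k Ω ∧ ContDiffOn ℝ 1 k (Ω ∩ {p | p.1 ≠ 0}) ∧
      ∀ t : ℝ, 0 < t → ∃ l₁ l₂ : ℂ, l₁ ≠ l₂ ∧
        Tendsto (FractionalWave.partialX k) (𝓝[{p | 0 < p.1}] ((0 : ℝ), t)) (𝓝 l₁) ∧
        Tendsto (FractionalWave.partialX k) (𝓝[{p | p.1 < 0}] ((0 : ℝ), t)) (𝓝 l₂)) ∧
    -- at no point of the closed half-line `∂K/∂x` is a continuous function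
    (∀ t : ℝ, 0 ≤ t → ¬ ∃ (U : Set (ℝ × ℝ)) (g : ℝ × ℝ → ℂ), IsOpen U ∧ ((0 : ℝ), t) ∈ U ∧
      FractionalWave.RepresentedOn
        (FractionalWave.distPartialX (FractionalWave.K μσ με a)) U g ∧
      ContinuousAt g ((0 : ℝ), t)) ∧
    -- near no point of the closed half-line `K` is a `C¹` function
    (∀ t : ℝ, 0 ≤ t → ¬ ∃ (U : Set (ℝ × ℝ)) (g : ℝ × ℝ → ℂ), IsOpen U ∧ ((0 : ℝ), t) ∈ U ∧
      FractionalWave.RepresentedOn (FractionalWave.K μσ με a) U g ∧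
      ContDiffOn ℝ 1 g U) := by
  have h : FractionalWave.Admissible μσ με :=
    ⟨hσ_supp, hε_supp, hσ_ne, hε_ne, hT, hproper, hprop⟩
  refine ⟨?_, fun t ht => FractionalWave.not_continuousAt_distPartialX_K h ha ht, ?_⟩
  · obtain ⟨P, hP⟩ := FractionalWave.exists_isContourBound h ha
    refine ⟨FractionalWave.cone P, FractionalWave.waveFun μσ με a, FractionalWave.isOpen_cone P,
      fun t ht => by simpa [FractionalWave.cone] using ht, FractionalWave.representedOn_K h ha hP,
      FractionalWave.continuousOn_waveFun h ha hP, FractionalWave.contDiffOn_waveFun h ha hP,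
      fun t ht => ⟨_, _, fun heq => ?_, FractionalWave.tendsto_partialX_waveFun h ha hP ht⟩⟩
    have hj := FractionalWave.jump_pos h ha ht
    have h0 : (FractionalWave.jump μσ με a t : ℂ) = 0 := by linear_combination heq
    exact hj.ne' (Complex.ofReal_eq_zero.1 h0)
  · rintro t ht ⟨U, g, hU, hmem, hrep, hg⟩
    exact FractionalWave.not_continuousAt_distPartialX_K h ha ht
      ⟨U, _, hU, hmem, hrep.distPartialX hU hg,
        (FractionalWave.continuousOn_partialX hU hg).continuousAt (hU.mem_nhds hmem)⟩
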